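/- Let $M$ and $Q$ be smooth Riemannian manifolds (finite-dimensional, without boundary), let $m=\dim M$, and let $\iota\colon M\to Q$ be a smooth isometric immersion. Let $\nabla$ and $\widetilde\nabla$ be the Levi-Civita connections of $M$ and $Q$, let $\alpha(X,Y)=\pi^{\perp}\widetilde\nabla_XY$ be the second fundamental form of $\iota$, where $\pi^{\perp}$ is the orthogonal projection onto the normal bundle, and let $\nabla^{\perp}=\pi^{\perp}\widetilde\nabla$ be the normal connection. For a normal vector $\eta$, let $A_\eta$ be the shape operator, given by $\langle A_\eta u,v\rangle=-\langle\alpha(u,v),\eta\rangle$, and let $H=m^{-1}\operatorname{tr}\alpha$ be the mean curvature vector. Suppose that - $\iota$ is totally umbilic, i.e. for every normal vector $\eta$ the shape operator $A_\eta$ is a multiple of the identity; and - $\iota$ has parallel normalized mean curvature vector, i.e. $H$ is nowhere zero and $\nabla^{\perp}_X(H/\lVert H\rVert)=0$ for all tangent vectors $X$ of $M$. A smooth unit-speed curve with tangent field $T$ in a Riemannian manifold with Levi-Civita connection $D$ is called *planar* if there are a smooth unit vector field $Y$ along it and a smooth real function $k$ on its parameter interval with $D_TT=kY$ and $D_TY=-kT$.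 Let $I\subseteq\mathbb R$ be an interval with more than one point, and let $\gamma\colon I\to M$ be a smooth curve whose extrinsic shape $\iota\circ\gamma$ is a planar unit-speed curve in $Q$; let $T$ be the tangent field of $\gamma$. Then $\gamma$ is a pseudo-geodesic with respect to $\alpha$, that is, $\gamma$ is unit-speed and there are a constant $c\in\mathbb R$ and a smooth unit vector field $Y$ along $\gamma$ such that $$\nabla_TT=c\,\lVert\alpha(T,T)\rVert\,Y \quad\text{on } I,$$ where, if the codimension of $\iota$ is one, $\lVert\alpha(T,T)\rVert$ is replaced by $\langle\alpha(T,T),\nu\rangle$ for a smooth unit normal field $\nu$ of $M$ along $\iota\circ\gamma$. In particular, the geodesic curvature $\kappa=\lVert\nabla_TT\rVert$ and the normal curvature $\tau=\lVert\alpha(T,T)\rVert$ of $\gamma$ satisfy $\kappa=c'\tau$ on $I$ for some constant $c'\in\mathbb R$. -/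

import Mathlib

open Bundle
open scoped Manifold ContDiff

noncomputable section

namespace PlanarShape

/-! Riemannian manifolds are finite-dimensional smooth manifolds (without boundary) modelled on
`EuclideanSpace ℝ (Fin m)` whose tangent bundle carries a smooth Riemannian metric. All sections and
curves below live on such manifolds. -/

section LeviCivita

variable {m : ℕ} {M : Type*} [TopologicalSpace M] [ChartedSpace (EuclideanSpace ℝ (Fin m)) M]
  [IsManifold (𝓡 m) ∞ M]

/-- Components, in the coordinates given by the preferred chart at `p`, of a tangent vector `v`
at a point `r` of the domain of that chart. -/
def tangentCoord (p r : M) (v : TangentSpace (𝓡 m) r) : EuclideanSpace ℝ (Fin m) :=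
  (trivializationAt (EuclideanSpace ℝ (Fin m)) (TangentSpace (𝓡 m)) p).continuousLinearMapAt ℝ r v

/-- The tangent vector at `r` whose components in the preferred chart at `p` are `a`. -/
def ofTangentCoord (p r : M) (a : EuclideanSpace ℝ (Fin m)) : TangentSpace (𝓡 m) r :=
  (trivializationAt (EuclideanSpace ℝ (Fin m)) (TangentSpace (𝓡 m)) p).symmL ℝ r a

variable [RiemannianBundle (fun x : M => TangentSpace (𝓡 m) x)]

/-- The components `g i j` of the metric in the preferred chart at `p`, as functions of the
coordinates `x`. -/
def metricCoeff (p : M) (x : EuclideanSpace ℝ (Fin m)) : Matrix (Fin m) (Fin m) ℝ :=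
  Matrix.of fun i j =>
    inner ℝ (ofTangentCoord p ((extChartAt (𝓡 m) p).symm x) (EuclideanSpace.single i 1))
      (ofTangentCoord p ((extChartAt (𝓡 m) p).symm x) (EuclideanSpace.single j 1))

/-- The partial derivative `∂ g i j / ∂ x l` in the preferred chart at `p`. -/
def metricPartial (p : M) (x : EuclideanSpace ℝ (Fin m)) (l i j : Fin m) : ℝ :=
  fderiv ℝ (fun y => metricCoeff p y i j) x (EuclideanSpace.single l 1)

/-- The Christoffel symbol `Γ^k_{ij}` of the Levi-Civita connection in the preferred chart at `p`:
`½ ∑ l, g^{kl} (∂_i g_{jl} + ∂_j g_{il} - ∂_l g_{ij})`. -/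
def christoffel (p : M) (x : EuclideanSpace ℝ (Fin m)) (i j k : Fin m) : ℝ :=
  (1 / 2) * ∑ l, (metricCoeff p x)⁻¹ k l *
    (metricPartial p x i j l + metricPartial p x j i l - metricPartial p x l i j)

/-- The vector with components `∑ i j, Γ^k_{ij} a^i b^j`. -/
def christoffelVec (p : M) (x a b : EuclideanSpace ℝ (Fin m)) : EuclideanSpace ℝ (Fin m) :=
  WithLp.toLp 2 fun k => ∑ i, ∑ j, christoffel p x i j k * a i * b j

variable {F : Type*} [NormedAddCommGroup F] [NormedSpace ℝ F] {H : Type*} [TopologicalSpace H]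
  (J : ModelWithCorners ℝ F H) {N : Type*} [TopologicalSpace N] [ChartedSpace H N]

/-- Levi-Civita covariant derivative, at `z ∈ s` and in the direction `u ∈ T_z N`, of a vector
field `W` along a map `f : s → M`, where `s ⊆ N`. In the chart of `M` at `f z` its `k`-th component
is `u(W^k) + ∑ i j, Γ^k_{ij} u(f^i) W^j`. Taking `N = ℝ` and `s` an interval gives the covariant
derivative of vector fields along a curve. -/
def covDeriv (f : N → M) (s : Set N) (W : ∀ z : N, TangentSpace (𝓡 m) (f z)) (z : N)
    (u : TangentSpace J z) : TangentSpace (𝓡 m) (f z) :=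
  let dW : EuclideanSpace ℝ (Fin m) :=
    mfderivWithin J (𝓡 m) (fun y => tangentCoord (f z) (f y) (W y)) s z u
  let df : EuclideanSpace ℝ (Fin m) :=
    mfderivWithin J (𝓡 m) (fun y => extChartAt (𝓡 m) (f z) (f y)) s z u
  ofTangentCoord (f z) (f z)
    (dW + christoffelVec (f z) (extChartAt (𝓡 m) (f z) (f z)) df (tangentCoord (f z) (f z) (W z)))

end LeviCivita

section Curves

variable (m : ℕ) {M : Type*} [TopologicalSpace M] [ChartedSpace (EuclideanSpace ℝ (Fin m)) M]
  [IsManifold (𝓡 m) ∞ M]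

/-- The velocity `T` of a curve `γ : I → M`. -/
def velocity (γ : ℝ → M) (I : Set ℝ) (t : ℝ) : TangentSpace (𝓡 m) (γ t) :=
  mfderivWithin 𝓘(ℝ, ℝ) (𝓡 m) γ I t (1 : ℝ)

/-- `V` is a smooth vector field along the curve `γ : I → M`. -/
def IsSmoothAlong (γ : ℝ → M) (I : Set ℝ) (V : ∀ t : ℝ, TangentSpace (𝓡 m) (γ t)) : Prop :=
  ContMDiffOn 𝓘(ℝ, ℝ) (𝓡 m).tangent ∞ (fun t => (⟨γ t, V t⟩ : TangentBundle (𝓡 m) M)) I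

variable [RiemannianBundle (fun x : M => TangentSpace (𝓡 m) x)]

/-- `V` is a smooth unit vector field along the curve `γ : I → M`. -/
def IsUnitFieldAlong (γ : ℝ → M) (I : Set ℝ) (V : ∀ t : ℝ, TangentSpace (𝓡 m) (γ t)) : Prop :=
  IsSmoothAlong m γ I V ∧ ∀ t ∈ I, ‖V t‖ = 1

/-- `γ : I → M` is a smooth unit-speed curve. -/
def IsUnitSpeedCurve (γ : ℝ → M) (I : Set ℝ) : Prop :=
  ContMDiffOn 𝓘(ℝ, ℝ) (𝓡 m) ∞ γ I ∧ ∀ t ∈ I, ‖velocity m γ I t‖ = 1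

/-- The covariant derivative `∇_T V` of a vector field `V` along `γ : I → M`. -/
def covDerivAlong (γ : ℝ → M) (I : Set ℝ) (V : ∀ t : ℝ, TangentSpace (𝓡 m) (γ t)) (t : ℝ) :
    TangentSpace (𝓡 m) (γ t) :=
  covDeriv 𝓘(ℝ, ℝ) γ I V t (1 : ℝ)

/-- The acceleration `∇_T T` of `γ : I → M`. -/
def acceleration (γ : ℝ → M) (I : Set ℝ) (t : ℝ) : TangentSpace (𝓡 m) (γ t) :=
  covDerivAlong m γ I (velocity m γ I) t

/-- A smooth unit-speed curve is planar if `∇_T T = κ Y` and `∇_T Y = -κ T` for some unit vector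
field `Y` along it and some smooth function `κ`. -/
def IsPlanar (γ : ℝ → M) (I : Set ℝ) : Prop :=
  IsUnitSpeedCurve m γ I ∧
    ∃ (Y : ∀ t : ℝ, TangentSpace (𝓡 m) (γ t)) (κ : ℝ → ℝ),
      IsUnitFieldAlong m γ I Y ∧ ContDiffOn ℝ ∞ κ I ∧
      ∀ t ∈ I, acceleration m γ I t = κ t • Y t ∧ covDerivAlong m γ I Y t = -κ t • velocity m γ I t

end Curves

section Immersions

variable (m q : ℕ) {M : Type*} [TopologicalSpace M] [ChartedSpace (EuclideanSpace ℝ (Fin m)) M]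
  [IsManifold (𝓡 m) ∞ M] [RiemannianBundle (fun x : M => TangentSpace (𝓡 m) x)]
  {Q : Type*} [TopologicalSpace Q] [ChartedSpace (EuclideanSpace ℝ (Fin q)) Q]
  [IsManifold (𝓡 q) ∞ Q] [RiemannianBundle (fun x : Q => TangentSpace (𝓡 q) x)]

instance finiteDimensional_tangentSpace (p : M) : FiniteDimensional ℝ (TangentSpace (𝓡 m) p) :=
  inferInstanceAs (FiniteDimensional ℝ (EuclideanSpace ℝ (Fin m)))

/-- `ι` is a (smooth) isometric immersion. Preserving inner products, its differential is
automatically injective. -/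
def IsIsometricImmersion (ι : M → Q) : Prop :=
  ContMDiff (𝓡 m) (𝓡 q) ∞ ι ∧
    ∀ (p : M) (u v : TangentSpace (𝓡 m) p),
      inner ℝ (mfderiv (𝓡 m) (𝓡 q) ι p u) (mfderiv (𝓡 m) (𝓡 q) ι p v) = inner ℝ u v

/-- The normal space `N_p M = (dι T_p M)ᗮ ⊆ T_{ι p} Q`. -/
def normalSpace (ι : M → Q) (p : M) : Submodule ℝ (TangentSpace (𝓡 q) (ι p)) :=
  (LinearMap.range (mfderiv (𝓡 m) (𝓡 q) ι p).toLinearMap)ᗮ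

/-- The orthogonal projection of `T_{ι p} Q` onto the normal space at `p`. -/
def normalProj (ι : M → Q) (p : M) (w : TangentSpace (𝓡 q) (ι p)) : TangentSpace (𝓡 q) (ι p) :=
  (normalSpace m q ι p).starProjection w

/-- The second fundamental form `α(u, v) = π^⊥ (∇~_u V)`, where `V` is a vector field of `M`
extending `v`, regarded as a field along `ι`. The result does not depend on the extension; we take
the one with constant components in the chart at `p`. -/
def secondFundamentalForm (ι : M → Q) (p : M) (u v : TangentSpace (𝓡 m) p) :
    TangentSpace (𝓡 q) (ι p) :=
  normalProj m q ι p (covDeriv (𝓡 m) ι Set.univ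
    (fun r => mfderiv (𝓡 m) (𝓡 q) ι r (ofTangentCoord p r (tangentCoord p p v))) p u)

/-- The mean curvature vector `m⁻¹ ∑ j, α(e_j, e_j)`, for an orthonormal basis of `T_p M`. -/
def meanCurvature (ι : M → Q) (p : M) : TangentSpace (𝓡 q) (ι p) :=
  (m : ℝ)⁻¹ • ∑ j, secondFundamentalForm m q ι p (stdOrthonormalBasis ℝ (TangentSpace (𝓡 m) p) j)
    (stdOrthonormalBasis ℝ (TangentSpace (𝓡 m) p) j)

/-- The shape operator in the direction of the normal vector `η`, characterized by
`⟨A_η u, v⟩ = -⟨α(u, v), η⟩` (the sign is such that `A_η u` is the tangential part of `∇~_u η`). -/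
def shapeOperator (ι : M → Q) (p : M) (η : TangentSpace (𝓡 q) (ι p)) (u : TangentSpace (𝓡 m) p) :
    TangentSpace (𝓡 m) p :=
  -∑ j, (inner ℝ (secondFundamentalForm m q ι p u (stdOrthonormalBasis ℝ (TangentSpace (𝓡 m) p) j)) η) •
    stdOrthonormalBasis ℝ (TangentSpace (𝓡 m) p) j

/-- All shape operators are multiples of the identity. -/
def IsTotallyUmbilic (ι : M → Q) : Prop :=
  ∀ (p : M), ∀ η ∈ normalSpace m q ι p, ∃ a : ℝ, ∀ u, shapeOperator m q ι p η u = a • u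

/-- The normal connection `∇^⊥_u ξ` of a normal field `ξ` along `ι`. -/
def normalCovDeriv (ι : M → Q) (ξ : ∀ p : M, TangentSpace (𝓡 q) (ι p)) (p : M)
    (u : TangentSpace (𝓡 m) p) : TangentSpace (𝓡 q) (ι p) :=
  normalProj m q ι p (covDeriv (𝓡 m) ι Set.univ ξ p u)

/-- The mean curvature vector `H` never vanishes and `H / ‖H‖` is parallel in the normal bundle. -/
def HasParallelNormalizedMeanCurvature (ι : M → Q) : Prop :=
  (∀ p : M, meanCurvature m q ι p ≠ 0) ∧
    ∀ (p : M) (u : TangentSpace (𝓡 m) p),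
      normalCovDeriv m q ι (fun r => ‖meanCurvature m q ι r‖⁻¹ • meanCurvature m q ι r) p u = 0

/-- The geodesic curvature `κ = ‖∇_T T‖`. -/
def geodesicCurvature (γ : ℝ → M) (I : Set ℝ) (t : ℝ) : ℝ :=
  ‖acceleration m γ I t‖

/-- The vector `α(T, T)` along a curve `γ : I → M`. -/
def normalAcceleration (ι : M → Q) (γ : ℝ → M) (I : Set ℝ) (t : ℝ) :
    TangentSpace (𝓡 q) (ι (γ t)) :=
  secondFundamentalForm m q ι (γ t) (velocity m γ I t) (velocity m γ I t)

/-- The normal curvature `τ = ‖α(T, T)‖`. -/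
def normalCurvature (ι : M → Q) (γ : ℝ → M) (I : Set ℝ) (t : ℝ) : ℝ :=
  ‖normalAcceleration m q ι γ I t‖

/-- `γ : I → M` is a `c`-pseudo-geodesic with respect to the second fundamental form of `ι`:
a unit-speed curve with `∇_T T = c ‖α(T, T)‖ Y` for some unit vector field `Y` along `γ`. When the
normal bundle has rank one, the scalar `⟨α(T, T), ν⟩` takes the place of `‖α(T, T)‖`, where `ν` is a
unit normal field along the curve, which identifies the normal lines with `ℝ`. -/
def IsPseudoGeodesicWith (c : ℝ) (ι : M → Q) (γ : ℝ → M) (I : Set ℝ) : Prop :=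
  IsUnitSpeedCurve m γ I ∧
    ∃ Y : ∀ t : ℝ, TangentSpace (𝓡 m) (γ t), IsUnitFieldAlong m γ I Y ∧
      if q = m + 1 then
        ∃ ν : ∀ t : ℝ, TangentSpace (𝓡 q) ((ι ∘ γ) t),
          IsUnitFieldAlong q (ι ∘ γ) I ν ∧ (∀ t ∈ I, ν t ∈ normalSpace m q ι (γ t)) ∧
          ∀ t ∈ I, acceleration m γ I t = (c * inner ℝ (normalAcceleration m q ι γ I t) (ν t)) • Y t
      else
        ∀ t ∈ I, acceleration m γ I t = (c * normalCurvature m q ι γ I t) • Y t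

/-- `γ` is a `c`-pseudo-geodesic for some constant `c`. -/
def IsPseudoGeodesic (ι : M → Q) (γ : ℝ → M) (I : Set ℝ) : Prop :=
  ∃ c : ℝ, IsPseudoGeodesicWith m q c ι γ I

end Immersions

end PlanarShape

end

/-!
The mean curvature vector `H` controls everything. On a totally umbilic immersion the second
fundamental form is `α(u, v) = ⟨u, v⟩ H` (`secondFundamentalForm_eq_of_umbilic`): pairing
`α(u, v) - ⟨u, v⟩ H` with itself and using umbilicity in that normal direction gives zero. Hence
for a unit-speed curve `α(T, T) = H`, and the Gauss formula turns the planarity equation into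
`k Y = dι (∇_T T) + H` with `k` nowhere zero.

Let `ν = H / ‖H‖` and `f = ⟨Y, ν⟩`. Pairing the last equation with `ν` gives `k f = ‖H‖`. Moreover
`f` is constant. Indeed `⟨∇~_T Y, ν⟩ = -k ⟨dι T, ν⟩ = 0`, so that `f' = ⟨Y, ∇~_T ν⟩`, and this is
zero because `k Y = dι (∇_T T) + H` is orthogonal to `∇~_T ν`: the part `H` is, since `ν` is
parallel in the normal bundle, and the part `dι (∇_T T)` is, since
`⟨dι (∇_T T), ∇~_T ν⟩ = -⟨α(T, ∇_T T), ν⟩ = -⟨T, ∇_T T⟩ ‖H‖ = 0`. Taking norms,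
`‖∇_T T‖² = k² - ‖H‖² = ‖H‖² (1 / f² - 1)`, which is the proportionality sought
(`exists_curvature_eq`), with `c = √(1 / f² - 1)`. The unit field of the pseudo-geodesic is
`∇_T T / (c ‖H‖)`, or any unit field, for instance `T`, when `c = 0`; in codimension one, `ν`
serves as the unit normal field.

The facts about the Levi-Civita connection along maps on which this rests are derived from its
definition by Christoffel symbols. Lowering an index turns the Christoffel symbols into the
trilinear form `christoffelForm`, whose transformation under a pullback of metrics is
`christoffelForm_pullback`. Applied to the chart expression of an isometric immersion, this says
that `dι` of the covariant derivative is the tangential part of the ambient one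
(`metricForm_chartCovDeriv`). For the identity map of `M`, read in two charts, it says that the
covariant derivative does not depend on the chart (`ofTangentCoord_chartCovDeriv`); for a general
immersion it gives the Gauss formula (`covDeriv_mfderiv`). Compatibility with the metric
(`dirDeriv_inner`) follows from the symmetrization `christoffelForm_add_swap`. Smoothness of `H` is
read off from `H = α(e, e) / ⟨e, e⟩` for a coordinate field `e`, which again uses umbilicity.
-/

noncomputable section
set_option synthInstance.maxHeartbeats 200000

namespace PlanarShape

open scoped Topology

/-! ### Christoffel symbols of the first kind -/

section MetricCalculus
variable {E E' : Type*} [NormedAddCommGroup E] [NormedSpace ℝ E] [NormedAddCommGroup E']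
  [NormedSpace ℝ E']

/-- The Christoffel symbols of the first kind of a metric `g` on a vector space, as a trilinear
form: `½ (D_a g(b, c) + D_b g(a, c) - D_c g(a, b))` for constant vector fields `a`, `b`, `c`. No
symmetry or nondegeneracy of `g` is built in. -/
def christoffelForm (g : E → E →L[ℝ] E →L[ℝ] ℝ) (x a b c : E) : ℝ :=
  (1 / 2) * (fderiv ℝ g x a b c + fderiv ℝ g x b a c - fderiv ℝ g x c a b)

lemma fderiv_form_apply {g : E → E →L[ℝ] E →L[ℝ] ℝ} {x : E} (hg : DifferentiableAt ℝ g x)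
    (u a b : E) : fderiv ℝ (fun y => g y a b) x u = fderiv ℝ g x u a b := by
  have h := (hg.hasFDerivAt.clm_apply (hasFDerivAt_const a x)).clm_apply (hasFDerivAt_const b x)
  rw [h.fderiv]
  simp

lemma fderiv_form_symm {g : E → E →L[ℝ] E →L[ℝ] ℝ} {x : E} (hg : DifferentiableAt ℝ g x)
    (hs : ∀ y a b, g y a b = g y b a) (u a b : E) :
    fderiv ℝ g x u a b = fderiv ℝ g x u b a := by
  rw [← fderiv_form_apply hg, ← fderiv_form_apply hg]
  simp_rw [hs _ a b]

/-- The symmetrization of the Christoffel symbols of the first kind is the derivative of the metric;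
this is compatibility with the metric. -/
lemma christoffelForm_add_swap {g : E → E →L[ℝ] E →L[ℝ] ℝ} {x : E} (hg : DifferentiableAt ℝ g x)
    (hs : ∀ y a b, g y a b = g y b a) (a b c : E) :
    christoffelForm g x a b c + christoffelForm g x a c b = fderiv ℝ g x a b c := by
  simp only [christoffelForm, fderiv_form_symm hg hs a c b]
  ring

/-- The transformation law of the Christoffel symbols of the first kind under a pullback
`g = Φ^* g'` of metrics. The second derivative of `Φ` survives in one place only, by its symmetry.
The map `Φ` need not be a local diffeomorphism, which is what makes this apply to immersions. -/
lemma christoffelForm_pullback {g : E → E →L[ℝ] E →L[ℝ] ℝ} {g' : E' → E' →L[ℝ] E' →L[ℝ] ℝ}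
    {Φ : E → E'} {x : E} (hΦ : ContDiffAt ℝ 2 Φ x) (hg : DifferentiableAt ℝ g x)
    (hg' : DifferentiableAt ℝ g' (Φ x)) (hs' : ∀ y a b, g' y a b = g' y b a)
    (h : ∀ᶠ y in 𝓝 x, ∀ a b, g y a b = g' (Φ y) (fderiv ℝ Φ y a) (fderiv ℝ Φ y b))
    (a b c : E) :
    christoffelForm g x a b c =
      christoffelForm g' (Φ x) (fderiv ℝ Φ x a) (fderiv ℝ Φ x b) (fderiv ℝ Φ x c) +
        g' (Φ x) (fderiv ℝ (fderiv ℝ Φ) x a b) (fderiv ℝ Φ x c) := by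
  have hΦ1 : HasFDerivAt Φ (fderiv ℝ Φ x) x := (hΦ.differentiableAt (by simp)).hasFDerivAt
  have hΦ2 : HasFDerivAt (fderiv ℝ Φ) (fderiv ℝ (fderiv ℝ Φ) x) x :=
    ((hΦ.fderiv_right (m := 1) (by norm_num)).differentiableAt (by simp)).hasFDerivAt
  have key : ∀ u a b : E, fderiv ℝ g x u a b =
      fderiv ℝ g' (Φ x) (fderiv ℝ Φ x u) (fderiv ℝ Φ x a) (fderiv ℝ Φ x b) +
      g' (Φ x) (fderiv ℝ (fderiv ℝ Φ) x u a) (fderiv ℝ Φ x b) +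
      g' (Φ x) (fderiv ℝ Φ x a) (fderiv ℝ (fderiv ℝ Φ) x u b) := by
    intro u a b
    rw [← fderiv_form_apply hg]
    have h1 := HasFDerivAt.comp (g := g') x hg'.hasFDerivAt hΦ1
    have h2 := (h1.clm_apply (hΦ2.clm_apply (hasFDerivAt_const a x))).clm_apply
      (hΦ2.clm_apply (hasFDerivAt_const b x))
    have h3 : (fun y => g y a b) =ᶠ[𝓝 x]
        fun y => g' (Φ y) (fderiv ℝ Φ y a) (fderiv ℝ Φ y b) := h.mono fun y hy => hy a b
    rw [h3.fderiv_eq, show fderiv ℝ (fun y => g' (Φ y) (fderiv ℝ Φ y a) (fderiv ℝ Φ y b)) x = _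
      from h2.fderiv]
    simp
    ring
  have hsymm : ∀ a b, fderiv ℝ (fderiv ℝ Φ) x a b = fderiv ℝ (fderiv ℝ Φ) x b a :=
    fun a b => (hΦ.isSymmSndFDerivAt (by simp)) a b
  simp only [christoffelForm, key]
  rw [hsymm c a, hsymm c b, hsymm b a, hs' _ (fderiv ℝ Φ x b) (fderiv ℝ (fderiv ℝ Φ) x a c),
    hs' _ (fderiv ℝ Φ x a) (fderiv ℝ (fderiv ℝ Φ) x b c)]
  ring

lemma christoffelForm_add_left (g : E → E →L[ℝ] E →L[ℝ] ℝ) (x a a' b c : E) :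
    christoffelForm g x (a + a') b c = christoffelForm g x a b c + christoffelForm g x a' b c := by
  simp only [christoffelForm, ContinuousLinearMap.map_add, _root_.add_apply]
  ring

lemma christoffelForm_add_middle (g : E → E →L[ℝ] E →L[ℝ] ℝ) (x a b b' c : E) :
    christoffelForm g x a (b + b') c = christoffelForm g x a b c + christoffelForm g x a b' c := by
  simp only [christoffelForm, ContinuousLinearMap.map_add, _root_.add_apply]
  ring

lemma christoffelForm_add_right (g : E → E →L[ℝ] E →L[ℝ] ℝ) (x a b c c' : E) :
    christoffelForm g x a b (c + c') = christoffelForm g x a b c + christoffelForm g x a b c' := by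
  simp only [christoffelForm, ContinuousLinearMap.map_add, _root_.add_apply]
  ring

lemma christoffelForm_smul_left (g : E → E →L[ℝ] E →L[ℝ] ℝ) (r : ℝ) (x a b c : E) :
    christoffelForm g x (r • a) b c = r * christoffelForm g x a b c := by
  simp only [christoffelForm, ContinuousLinearMap.map_smul, _root_.smul_apply, smul_eq_mul]
  ring

lemma christoffelForm_smul_middle (g : E → E →L[ℝ] E →L[ℝ] ℝ) (r : ℝ) (x a b c : E) :
    christoffelForm g x a (r • b) c = r * christoffelForm g x a b c := by
  simp only [christoffelForm, ContinuousLinearMap.map_smul, _root_.smul_apply, smul_eq_mul]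
  ring

lemma christoffelForm_smul_right (g : E → E →L[ℝ] E →L[ℝ] ℝ) (r : ℝ) (x a b c : E) :
    christoffelForm g x a b (r • c) = r * christoffelForm g x a b c := by
  simp only [christoffelForm, ContinuousLinearMap.map_smul, _root_.smul_apply, smul_eq_mul]
  ring

lemma contDiffAt_smul_const {n : ℕ∞ω} {f : E → ℝ} {x : E} (hf : ContDiffAt ℝ n f x) (v : E') :
    ContDiffAt ℝ n (fun y => f y • v) x :=
  hf.smul contDiffAt_const

end MetricCalculus

/-! ### The metric and the Christoffel symbols in a chart -/

section MetricChart
variable {m : ℕ} {M : Type*} [TopologicalSpace M] [ChartedSpace (EuclideanSpace ℝ (Fin m)) M]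
  [IsManifold (𝓡 m) ∞ M]

lemma mem_baseSet {p r : M} (h : r ∈ (chartAt (EuclideanSpace ℝ (Fin m)) p).source) :
    r ∈ (trivializationAt (EuclideanSpace ℝ (Fin m)) (TangentSpace (𝓡 m)) p).baseSet := h

lemma ofTangentCoord_tangentCoord {p r : M}
    (h : r ∈ (chartAt (EuclideanSpace ℝ (Fin m)) p).source) (v : TangentSpace (𝓡 m) r) :
    ofTangentCoord p r (tangentCoord p r v) = v :=
  (trivializationAt _ (TangentSpace (𝓡 m)) p).symmL_continuousLinearMapAt (mem_baseSet h) v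

lemma tangentCoord_ofTangentCoord {p r : M}
    (h : r ∈ (chartAt (EuclideanSpace ℝ (Fin m)) p).source) (a : EuclideanSpace ℝ (Fin m)) :
    tangentCoord p r (ofTangentCoord p r a) = a :=
  (trivializationAt _ (TangentSpace (𝓡 m)) p).continuousLinearMapAt_symmL (mem_baseSet h) a

lemma tangentCoord_injective {p r : M} (hr : r ∈ (chartAt (EuclideanSpace ℝ (Fin m)) p).source)
    {v w : TangentSpace (𝓡 m) r} (h : tangentCoord p r v = tangentCoord p r w) : v = w := by
  rw [← ofTangentCoord_tangentCoord hr v, h, ofTangentCoord_tangentCoord hr]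

lemma tangentCoord_eq_mfderiv {p r : M}
    (h : r ∈ (chartAt (EuclideanSpace ℝ (Fin m)) p).source) (v : TangentSpace (𝓡 m) r) :
    tangentCoord p r v = mfderiv (𝓡 m) (𝓡 m) (extChartAt (𝓡 m) p) r v := by
  unfold tangentCoord
  rw [TangentBundle.continuousLinearMapAt_trivializationAt h]
  rfl

lemma tangentCoord_eq_trivializationAt {p r : M}
    (h : r ∈ (chartAt (EuclideanSpace ℝ (Fin m)) p).source) (v : TangentSpace (𝓡 m) r) :
    tangentCoord p r v =
      (trivializationAt (EuclideanSpace ℝ (Fin m)) (TangentSpace (𝓡 m)) p ⟨r, v⟩).2 := by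
  unfold tangentCoord
  rw [Trivialization.continuousLinearMapAt_apply,
    Trivialization.coe_linearMapAt_of_mem _ (mem_baseSet h)]

@[simp] lemma tangentCoord_add (p r : M) (v w : TangentSpace (𝓡 m) r) :
    tangentCoord p r (v + w) = tangentCoord p r v + tangentCoord p r w := map_add _ v w

@[simp] lemma tangentCoord_smul (p r : M) (c : ℝ) (v : TangentSpace (𝓡 m) r) :
    tangentCoord p r (c • v) = c • tangentCoord p r v := map_smul _ c v

@[simp] lemma ofTangentCoord_add (p r : M) (a b : EuclideanSpace ℝ (Fin m)) :
    ofTangentCoord p r (a + b) = ofTangentCoord p r a + ofTangentCoord p r b := map_add _ a b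

variable [RiemannianBundle (fun x : M => TangentSpace (𝓡 m) x)]

variable (m) in
/-- The metric in the preferred chart at `p`, as a bilinear form on the model space depending on the
coordinates `x`. Off the target of the chart it inherits the junk values of `metricCoeff`. -/
def metricForm (p : M) (x : EuclideanSpace ℝ (Fin m)) :
    EuclideanSpace ℝ (Fin m) →L[ℝ] EuclideanSpace ℝ (Fin m) →L[ℝ] ℝ :=
  ∑ i, ∑ j, metricCoeff p x i j •
    (EuclideanSpace.proj i : EuclideanSpace ℝ (Fin m) →L[ℝ] ℝ).smulRight
      (EuclideanSpace.proj j : EuclideanSpace ℝ (Fin m) →L[ℝ] ℝ)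

lemma metricForm_eq_sum (p : M) (x a b : EuclideanSpace ℝ (Fin m)) :
    metricForm m p x a b = ∑ i, ∑ j, metricCoeff p x i j * a i * b j := by
  simp [metricForm, mul_assoc]

lemma euclidean_eq_sum (a : EuclideanSpace ℝ (Fin m)) :
    a = ∑ i, a i • EuclideanSpace.single i (1 : ℝ) := by
  ext k
  simp [Finset.sum_apply, Pi.single_apply]

omit [RiemannianBundle (fun x : M => TangentSpace (𝓡 m) x)] in
lemma ofTangentCoord_eq_sum (p r : M) (a : EuclideanSpace ℝ (Fin m)) :
    ofTangentCoord p r a = ∑ i, a i • ofTangentCoord p r (EuclideanSpace.single i 1) := by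
  conv_lhs => rw [euclidean_eq_sum a]
  simp only [ofTangentCoord, map_sum, map_smul]

lemma metricForm_apply (p : M) (x a b : EuclideanSpace ℝ (Fin m)) :
    metricForm m p x a b = inner ℝ (ofTangentCoord p ((extChartAt (𝓡 m) p).symm x) a)
      (ofTangentCoord p ((extChartAt (𝓡 m) p).symm x) b) := by
  rw [metricForm_eq_sum, ofTangentCoord_eq_sum _ _ a, ofTangentCoord_eq_sum _ _ b, sum_inner]
  refine Finset.sum_congr rfl fun i _ => ?_
  rw [inner_sum]
  refine Finset.sum_congr rfl fun j _ => ?_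
  rw [inner_smul_left, inner_smul_right]
  simp [metricCoeff]
  ring

lemma metricForm_symm (p : M) (x a b : EuclideanSpace ℝ (Fin m)) :
    metricForm m p x a b = metricForm m p x b a := by
  rw [metricForm_apply, metricForm_apply, real_inner_comm]

lemma metricForm_tangentCoord {p r : M}
    (h : r ∈ (chartAt (EuclideanSpace ℝ (Fin m)) p).source) (v w : TangentSpace (𝓡 m) r) :
    metricForm m p (extChartAt (𝓡 m) p r) (tangentCoord p r v) (tangentCoord p r w) =
      inner ℝ v w := by
  have key : ∀ r' : M, r' = r → inner ℝ (ofTangentCoord p r' (tangentCoord p r v))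
      (ofTangentCoord p r' (tangentCoord p r w)) = inner ℝ v w := by
    rintro r' rfl
    rw [ofTangentCoord_tangentCoord h, ofTangentCoord_tangentCoord h]
  rw [metricForm_apply]
  exact key _ ((extChartAt (𝓡 m) p).left_inv (by rwa [extChartAt_source]))

omit [IsManifold (𝓡 m) ∞ M] [RiemannianBundle (fun x : M => TangentSpace (𝓡 m) x)] in
lemma symm_mem_source {p : M} {x : EuclideanSpace ℝ (Fin m)}
    (hx : x ∈ (extChartAt (𝓡 m) p).target) :
    (extChartAt (𝓡 m) p).symm x ∈ (chartAt (EuclideanSpace ℝ (Fin m)) p).source := by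
  rw [← extChartAt_source (𝓡 m)]
  exact (extChartAt (𝓡 m) p).map_target hx

lemma metricForm_pos {p : M} {x a : EuclideanSpace ℝ (Fin m)}
    (hx : x ∈ (extChartAt (𝓡 m) p).target) (ha : a ≠ 0) : 0 < metricForm m p x a a := by
  rw [metricForm_apply]
  refine real_inner_self_pos.2 fun h => ha ?_
  rw [← tangentCoord_ofTangentCoord (symm_mem_source hx) a, h]
  exact map_zero _

lemma metricCoeff_eq (p : M) (x : EuclideanSpace ℝ (Fin m)) (i j : Fin m) :
    metricCoeff p x i j =
      metricForm m p x (EuclideanSpace.single i 1) (EuclideanSpace.single j 1) := by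
  rw [metricForm_apply]; rfl

/-- Invertibility of the metric matrix, without which the inverse in `christoffel` would be a junk
value. -/
lemma isUnit_metricCoeff {p : M} {x : EuclideanSpace ℝ (Fin m)}
    (hx : x ∈ (extChartAt (𝓡 m) p).target) : IsUnit (metricCoeff p x) := by
  rw [Matrix.isUnit_iff_isUnit_det, isUnit_iff_ne_zero]
  intro h
  obtain ⟨v, hv, hv'⟩ := Matrix.exists_mulVec_eq_zero_iff.2 h
  have hpos := metricForm_pos hx (a := WithLp.toLp 2 v) (by simpa using hv)
  have : metricForm m p x (WithLp.toLp 2 v) (WithLp.toLp 2 v) =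
      v ⬝ᵥ (metricCoeff p x).mulVec v := by
    rw [metricForm_eq_sum]
    simp only [dotProduct, Matrix.mulVec, Finset.mul_sum]
    refine Finset.sum_congr rfl fun i _ => Finset.sum_congr rfl fun j _ => ?_
    ring
  rw [this, hv', dotProduct_zero] at hpos
  exact lt_irrefl _ hpos

section Smooth
variable {F : Type*} [NormedAddCommGroup F] [NormedSpace ℝ F] {H : Type*} [TopologicalSpace H]
  {J : ModelWithCorners ℝ F H} {N : Type*} [TopologicalSpace N] [ChartedSpace H N]

omit [RiemannianBundle (fun x : M => TangentSpace (𝓡 m) x)] in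
/-- Smoothness of a field along a map can be tested on its components in any chart around the
point. -/
lemma contMDiffWithinAt_field_iff {f : N → M} {W : ∀ y, TangentSpace (𝓡 m) (f y)}
    {s : Set N} {z : N} {p : M} (hz : f z ∈ (chartAt (EuclideanSpace ℝ (Fin m)) p).source) :
    ContMDiffWithinAt J (𝓡 m).tangent ∞ (fun y => (⟨f y, W y⟩ : TangentBundle (𝓡 m) M)) s z ↔
      ContMDiffWithinAt J (𝓡 m) ∞ f s z ∧
        ContMDiffWithinAt J (𝓡 m) ∞ (fun y => tangentCoord p (f y) (W y)) s z := by
  rw [(trivializationAt (EuclideanSpace ℝ (Fin m)) (TangentSpace (𝓡 m)) p).contMDiffWithinAt_iff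
    (by rw [Trivialization.mem_source]; exact hz)]
  refine and_congr_right fun hf => ?_
  have hev : ∀ᶠ y in 𝓝[s] z, f y ∈ (chartAt (EuclideanSpace ℝ (Fin m)) p).source :=
    hf.continuousWithinAt ((chartAt _ p).open_source.mem_nhds hz)
  have h1 : (fun y => tangentCoord p (f y) (W y)) =ᶠ[𝓝[s] z] fun y => (trivializationAt
      (EuclideanSpace ℝ (Fin m)) (TangentSpace (𝓡 m)) p ⟨f y, W y⟩).2 := by
    filter_upwards [hev] with y hy using tangentCoord_eq_trivializationAt hy _
  exact (h1.contMDiffWithinAt_iff (tangentCoord_eq_trivializationAt hz _)).symm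

omit [RiemannianBundle (fun x : M => TangentSpace (𝓡 m) x)] in
lemma contMDiffWithinAt_extChartAt_comp {f : N → M} {s : Set N} {z : N}
    {p : M} (hz : f z ∈ (chartAt (EuclideanSpace ℝ (Fin m)) p).source)
    (hf : ContMDiffWithinAt J (𝓡 m) ∞ f s z) :
    ContMDiffWithinAt J (𝓡 m) ∞ (fun y => extChartAt (𝓡 m) p (f y)) s z :=
  (contMDiffAt_extChartAt' hz).comp_contMDiffWithinAt z hf
end Smooth

omit [RiemannianBundle (fun x : M => TangentSpace (𝓡 m) x)] in
lemma contMDiffAt_ofTangentCoord {p r : M}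
    (hr : r ∈ (chartAt (EuclideanSpace ℝ (Fin m)) p).source) (a : EuclideanSpace ℝ (Fin m)) :
    ContMDiffAt (𝓡 m) (𝓡 m).tangent ∞
      (fun r => (⟨r, ofTangentCoord p r a⟩ : TangentBundle (𝓡 m) M)) r := by
  refine (contMDiffWithinAt_field_iff (s := Set.univ) hr).2 ⟨contMDiffWithinAt_id, ?_⟩
  have : (fun y => tangentCoord p y (ofTangentCoord p y a)) =ᶠ[𝓝 r] fun _ => a := by
    filter_upwards [(chartAt _ p).open_source.mem_nhds hr] with y hy
      using tangentCoord_ofTangentCoord hy a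
  exact contMDiffAt_const.congr_of_eventuallyEq this

variable [IsContMDiffRiemannianBundle (𝓡 m) ∞ (EuclideanSpace ℝ (Fin m))
      (fun x : M => TangentSpace (𝓡 m) x)]

lemma contDiffAt_metricCoeff {p : M} {x : EuclideanSpace ℝ (Fin m)}
    (hx : x ∈ (extChartAt (𝓡 m) p).target) (i j : Fin m) :
    ContDiffAt ℝ ∞ (fun y => metricCoeff p y i j) x := by
  have hr := symm_mem_source hx
  have h1 := ContMDiffAt.inner_bundle (F := EuclideanSpace ℝ (Fin m))
    (E := fun x : M => TangentSpace (𝓡 m) x)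
    (contMDiffAt_ofTangentCoord hr (EuclideanSpace.single i 1))
    (contMDiffAt_ofTangentCoord hr (EuclideanSpace.single j 1))
  have h2 : ContMDiffAt (𝓡 m) (𝓡 m) ∞ (extChartAt (𝓡 m) p).symm x :=
    (contMDiffOn_extChartAt_symm p).contMDiffAt ((isOpen_extChartAt_target p).mem_nhds hx)
  exact (ContMDiffAt.comp x h1 h2).contDiffAt

lemma contDiffAt_metricForm {p : M} {x : EuclideanSpace ℝ (Fin m)}
    (hx : x ∈ (extChartAt (𝓡 m) p).target) : ContDiffAt ℝ ∞ (metricForm m p) x := by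
  unfold metricForm
  refine ContDiffAt.sum fun i _ => ContDiffAt.sum fun j _ => ?_
  exact contDiffAt_smul_const
    (E' := EuclideanSpace ℝ (Fin m) →L[ℝ] EuclideanSpace ℝ (Fin m) →L[ℝ] ℝ)
    (contDiffAt_metricCoeff hx i j) _

lemma differentiableAt_metricForm {p : M} {x : EuclideanSpace ℝ (Fin m)}
    (hx : x ∈ (extChartAt (𝓡 m) p).target) : DifferentiableAt ℝ (metricForm m p) x :=
  (contDiffAt_metricForm hx).differentiableAt (by simp)

lemma metricPartial_eq {p : M} {x : EuclideanSpace ℝ (Fin m)}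
    (hx : x ∈ (extChartAt (𝓡 m) p).target) (l i j : Fin m) :
    metricPartial p x l i j = fderiv ℝ (metricForm m p) x (EuclideanSpace.single l 1)
      (EuclideanSpace.single i 1) (EuclideanSpace.single j 1) := by
  rw [metricPartial, ← fderiv_form_apply (differentiableAt_metricForm hx)]
  simp_rw [metricCoeff_eq]

lemma christoffelForm_eq_sum (g : EuclideanSpace ℝ (Fin m) →
      EuclideanSpace ℝ (Fin m) →L[ℝ] EuclideanSpace ℝ (Fin m) →L[ℝ] ℝ)
    (x a b c : EuclideanSpace ℝ (Fin m)) :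
    christoffelForm g x a b c = ∑ i, ∑ j, a i * b j * christoffelForm g x
      (EuclideanSpace.single i 1) (EuclideanSpace.single j 1) c := by
  let B : EuclideanSpace ℝ (Fin m) →ₗ[ℝ] EuclideanSpace ℝ (Fin m) →ₗ[ℝ] ℝ :=
    LinearMap.mk₂ ℝ (fun a b => christoffelForm g x a b c)
      (fun a a' b => christoffelForm_add_left g x a a' b c)
      (fun r a b => christoffelForm_smul_left g r x a b c)
      (fun a b b' => christoffelForm_add_middle g x a b b' c)
      (fun r a b => christoffelForm_smul_middle g r x a b c)
  change B a b = ∑ i, ∑ j, a i * b j * B (EuclideanSpace.single i 1) (EuclideanSpace.single j 1)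
  conv_lhs => rw [euclidean_eq_sum a, euclidean_eq_sum b]
  simp only [map_sum, map_smul, LinearMap.sum_apply, LinearMap.smul_apply, smul_eq_mul,
    Finset.mul_sum]
  rw [Finset.sum_comm]
  refine Finset.sum_congr rfl fun i _ => Finset.sum_congr rfl fun j _ => ?_
  ring

lemma christoffelVec_eq {p : M} {x : EuclideanSpace ℝ (Fin m)}
    (hx : x ∈ (extChartAt (𝓡 m) p).target) (a b : EuclideanSpace ℝ (Fin m)) :
    christoffelVec p x a b = WithLp.toLp 2 ((metricCoeff p x)⁻¹.mulVec fun l =>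
      christoffelForm (metricForm m p) x a b (EuclideanSpace.single l 1)) := by
  ext k
  simp only [christoffelVec, Matrix.mulVec, dotProduct]
  simp_rw [christoffelForm_eq_sum _ x a b, Finset.mul_sum]
  conv_rhs => rw [Finset.sum_comm]
  refine Finset.sum_congr rfl fun i _ => ?_
  conv_rhs => rw [Finset.sum_comm]
  refine Finset.sum_congr rfl fun j _ => ?_
  simp only [christoffel, christoffelForm, metricPartial_eq hx, Finset.mul_sum, Finset.sum_mul]
  refine Finset.sum_congr rfl fun l _ => ?_
  ring

/-- Lowering the index of the Christoffel symbols `Γ^k_{ij}` gives the Christoffel symbols of the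
first kind. -/
lemma metricForm_christoffelVec {p : M} {x : EuclideanSpace ℝ (Fin m)}
    (hx : x ∈ (extChartAt (𝓡 m) p).target) (a b c : EuclideanSpace ℝ (Fin m)) :
    metricForm m p x (christoffelVec p x a b) c = christoffelForm (metricForm m p) x a b c := by
  have hinv := Matrix.mul_nonsing_inv (metricCoeff p x)
    ((Matrix.isUnit_iff_isUnit_det _).1 (isUnit_metricCoeff hx))
  rw [metricForm_symm]
  set w : Fin m → ℝ := fun l =>
    christoffelForm (metricForm m p) x a b (EuclideanSpace.single l 1) with hw
  have h1 : metricForm m p x c (christoffelVec p x a b) =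
      c.ofLp ⬝ᵥ (metricCoeff p x).mulVec ((metricCoeff p x)⁻¹.mulVec w) := by
    rw [christoffelVec_eq hx, metricForm_eq_sum]
    simp only [dotProduct, Matrix.mulVec, Finset.mul_sum]
    refine Finset.sum_congr rfl fun i _ => Finset.sum_congr rfl fun j _ =>
      Finset.sum_congr rfl fun l _ => ?_
    ring
  rw [h1, Matrix.mulVec_mulVec, hinv, Matrix.one_mulVec]
  let B : EuclideanSpace ℝ (Fin m) →ₗ[ℝ] ℝ :=
    { toFun := fun c => christoffelForm (metricForm m p) x a b c
      map_add' := fun c c' => christoffelForm_add_right _ x a b c c'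
      map_smul' := fun r c => christoffelForm_smul_right _ r x a b c }
  change ∑ i, c i * B (EuclideanSpace.single i 1) = B c
  conv_rhs => rw [euclidean_eq_sum c]
  simp only [map_sum, map_smul, smul_eq_mul]

end MetricChart

section ChristoffelSmooth
variable {m : ℕ} {M : Type*} [TopologicalSpace M] [ChartedSpace (EuclideanSpace ℝ (Fin m)) M]
  [IsManifold (𝓡 m) ∞ M] [RiemannianBundle (fun x : M => TangentSpace (𝓡 m) x)]
  [IsContMDiffRiemannianBundle (𝓡 m) ∞ (EuclideanSpace ℝ (Fin m))
      (fun x : M => TangentSpace (𝓡 m) x)]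

attribute [local instance] Matrix.linftyOpNormedRing Matrix.linftyOpNormedAlgebra
  Matrix.linftyOpNormedAddCommGroup Matrix.linftyOpNormedSpace in
/-- Smoothness of the inverse metric. The matrix norm is auxiliary: it makes the matrices a complete
normed algebra, in which inversion is smooth at units. -/
lemma contDiffAt_inv_metricCoeff {p : M} {x : EuclideanSpace ℝ (Fin m)}
    (hx : x ∈ (extChartAt (𝓡 m) p).target) (k l : Fin m) :
    ContDiffAt ℝ ∞ (fun y : EuclideanSpace ℝ (Fin m) => (metricCoeff p y)⁻¹ k l) x := by
  obtain ⟨u, hu⟩ := isUnit_metricCoeff (m := m) hx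
  have h1 : ContDiffAt ℝ ∞ (fun y : EuclideanSpace ℝ (Fin m) => metricCoeff p y) x := by
    have hsum : (fun y : EuclideanSpace ℝ (Fin m) => metricCoeff p y) =
        fun y => ∑ i, ∑ j, metricCoeff p y i j • Matrix.single i j (1 : ℝ) := by
      funext y
      conv_lhs => rw [Matrix.matrix_eq_sum_single (metricCoeff p y)]
      simp
    rw [hsum]
    exact ContDiffAt.sum fun i _ => ContDiffAt.sum fun j _ =>
      (contDiffAt_metricCoeff hx i j).smul contDiffAt_const
  have h2 : ContDiffAt ℝ ∞ (fun y : EuclideanSpace ℝ (Fin m) => (metricCoeff p y)⁻¹) x := by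
    simp_rw [Matrix.nonsing_inv_eq_ringInverse]
    have := contDiffAt_ringInverse ℝ (n := ∞) u
    rw [hu] at this
    exact ContDiffAt.comp x this h1
  let ev : Matrix (Fin m) (Fin m) ℝ →ₗ[ℝ] ℝ := Matrix.entryLinearMap ℝ ℝ k l
  exact (LinearMap.toContinuousLinearMap ev).contDiff.contDiffAt.comp x h2

lemma contDiffAt_christoffel {p : M} {x : EuclideanSpace ℝ (Fin m)}
    (hx : x ∈ (extChartAt (𝓡 m) p).target) (i j k : Fin m) :
    ContDiffAt ℝ ∞ (fun y => christoffel p y i j k) x := by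
  have h : ∀ l i j, ContDiffAt ℝ ∞ (fun y => metricPartial p y l i j) x := fun l i j =>
    ((contDiffAt_metricCoeff hx i j).fderiv_right (m := ∞) (by simp)).clm_apply contDiffAt_const
  unfold christoffel
  exact contDiffAt_const.mul (ContDiffAt.sum fun l _ =>
    (contDiffAt_inv_metricCoeff hx k l).mul (((h _ _ _).add (h _ _ _)).sub (h _ _ _)))

lemma contMDiffWithinAt_christoffelVec {F : Type*} [NormedAddCommGroup F]
    [NormedSpace ℝ F] {H : Type*} [TopologicalSpace H]
    {J : ModelWithCorners ℝ F H} {N : Type*} [TopologicalSpace N] [ChartedSpace H N] {p : M}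
    {x a b : N → EuclideanSpace ℝ (Fin m)} {s : Set N} {z : N}
    (hz : x z ∈ (extChartAt (𝓡 m) p).target) (hx : ContMDiffWithinAt J (𝓡 m) ∞ x s z)
    (ha : ContMDiffWithinAt J (𝓡 m) ∞ a s z) (hb : ContMDiffWithinAt J (𝓡 m) ∞ b s z) :
    ContMDiffWithinAt J (𝓡 m) ∞ (fun y => christoffelVec p (x y) (a y) (b y)) s z := by
  have h : ContDiffAt ℝ ∞ (fun y : EuclideanSpace ℝ (Fin m) × EuclideanSpace ℝ (Fin m) ×
      EuclideanSpace ℝ (Fin m) =>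
      christoffelVec p y.1 y.2.1 y.2.2) (x z, a z, b z) := by
    unfold christoffelVec
    refine contDiffAt_euclidean.2 fun k => ?_
    change ContDiffAt ℝ ∞ (fun y : EuclideanSpace ℝ (Fin m) × EuclideanSpace ℝ (Fin m) ×
        EuclideanSpace ℝ (Fin m) =>
      ∑ i, ∑ j, christoffel p y.1 i j k * y.2.1 i * y.2.2 j) (x z, a z, b z)
    refine ContDiffAt.sum fun i _ => ContDiffAt.sum fun j _ => ?_
    have hc : ContDiffAt ℝ ∞ (fun y => christoffel p y i j k) (x z) :=
      contDiffAt_christoffel hz i j k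
    refine (((ContDiffAt.comp (x z, a z, b z) hc contDiffAt_fst).mul ?_).mul ?_)
    · exact ((EuclideanSpace.proj i : EuclideanSpace ℝ (Fin m) →L[ℝ] ℝ).contDiff.comp
        (contDiff_fst.comp contDiff_snd)).contDiffAt
    · exact ((EuclideanSpace.proj j : EuclideanSpace ℝ (Fin m) →L[ℝ] ℝ).contDiff.comp
        (contDiff_snd.comp contDiff_snd)).contDiffAt
  exact h.contMDiffAt.comp_contMDiffWithinAt z (f := fun y => (x y, a y, b y))
    (hx.prodMk_space (ha.prodMk_space hb))

end ChristoffelSmooth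

/-! ### Chart expressions of maps and of the covariant derivative -/

section ChartExpr
variable {m q : ℕ} {M : Type*} [TopologicalSpace M] [ChartedSpace (EuclideanSpace ℝ (Fin m)) M]
  [IsManifold (𝓡 m) ∞ M]
  {Q : Type*} [TopologicalSpace Q] [ChartedSpace (EuclideanSpace ℝ (Fin q)) Q]
  [IsManifold (𝓡 q) ∞ Q]

variable (m q) in
/-- The expression of a map `ι : M → Q` in the preferred charts at `p` and `p'`. -/
def chartExpr (ι : M → Q) (p : M) (p' : Q) (x : EuclideanSpace ℝ (Fin m)) :
    EuclideanSpace ℝ (Fin q) :=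
  extChartAt (𝓡 q) p' (ι ((extChartAt (𝓡 m) p).symm x))

omit [IsManifold (𝓡 m) ∞ M] [IsManifold (𝓡 q) ∞ Q] in
lemma chartExpr_extChartAt (ι : M → Q) {p r : M} (p' : Q)
    (hr : r ∈ (chartAt (EuclideanSpace ℝ (Fin m)) p).source) :
    chartExpr m q ι p p' (extChartAt (𝓡 m) p r) = extChartAt (𝓡 q) p' (ι r) := by
  rw [chartExpr, (extChartAt (𝓡 m) p).left_inv (by rwa [extChartAt_source])]

omit [IsManifold (𝓡 m) ∞ M] in
lemma extChartAt_mem_target {p r : M}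
    (hr : r ∈ (chartAt (EuclideanSpace ℝ (Fin m)) p).source) :
    extChartAt (𝓡 m) p r ∈ (extChartAt (𝓡 m) p).target :=
  (extChartAt (𝓡 m) p).map_source (by rwa [extChartAt_source])

lemma contDiffAt_chartExpr {ι : M → Q} (hι : ContMDiff (𝓡 m) (𝓡 q) ∞ ι) {p : M} {p' : Q}
    {x : EuclideanSpace ℝ (Fin m)} (hx : x ∈ (extChartAt (𝓡 m) p).target)
    (hx' : ι ((extChartAt (𝓡 m) p).symm x) ∈ (chartAt (EuclideanSpace ℝ (Fin q)) p').source) :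
    ContDiffAt ℝ ∞ (chartExpr m q ι p p') x := by
  have h2 : ContMDiffAt (𝓡 m) (𝓡 m) ∞ (extChartAt (𝓡 m) p).symm x :=
    (contMDiffOn_extChartAt_symm p).contMDiffAt ((isOpen_extChartAt_target p).mem_nhds hx)
  have h3 := ContMDiffAt.comp x (hι ((extChartAt (𝓡 m) p).symm x)) h2
  exact (ContMDiffAt.comp x (contMDiffAt_extChartAt' (I := 𝓡 q) hx') h3).contDiffAt

lemma contDiffAt_chartExpr_extChartAt {ι : M → Q} (hι : ContMDiff (𝓡 m) (𝓡 q) ∞ ι) {p r : M}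
    {p' : Q} (hr : r ∈ (chartAt (EuclideanSpace ℝ (Fin m)) p).source)
    (hr' : ι r ∈ (chartAt (EuclideanSpace ℝ (Fin q)) p').source) :
    ContDiffAt ℝ ∞ (chartExpr m q ι p p') (extChartAt (𝓡 m) p r) := by
  refine contDiffAt_chartExpr hι (extChartAt_mem_target hr) ?_
  rwa [(extChartAt (𝓡 m) p).left_inv (by rwa [extChartAt_source])]

lemma mdifferentiableAt_extChartAt_of_mem {p r : M}
    (hr : r ∈ (chartAt (EuclideanSpace ℝ (Fin m)) p).source) :
    MDifferentiableAt (𝓡 m) (𝓡 m) (extChartAt (𝓡 m) p) r :=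
  (contMDiffAt_extChartAt' (I := 𝓡 m) (n := ∞) hr).mdifferentiableAt (by simp)

/-- In coordinates, the differential of `ι` is the derivative of its chart expression. -/
lemma tangentCoord_mfderiv {ι : M → Q} (hι : ContMDiff (𝓡 m) (𝓡 q) ∞ ι) {p r : M}
    {p' : Q} (hr : r ∈ (chartAt (EuclideanSpace ℝ (Fin m)) p).source)
    (hr' : ι r ∈ (chartAt (EuclideanSpace ℝ (Fin q)) p').source) (v : TangentSpace (𝓡 m) r) :
    tangentCoord p' (ι r) (mfderiv (𝓡 m) (𝓡 q) ι r v) =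
      fderiv ℝ (chartExpr m q ι p p') (extChartAt (𝓡 m) p r) (tangentCoord p r v) := by
  rw [tangentCoord_eq_mfderiv hr, tangentCoord_eq_mfderiv hr', ← mfderiv_eq_fderiv]
  have hΦ : MDifferentiableAt (𝓡 m) (𝓡 q) (chartExpr m q ι p p') (extChartAt (𝓡 m) p r) :=
    ((contDiffAt_chartExpr_extChartAt hι hr hr').differentiableAt (by simp)).mdifferentiableAt
  have h1 := mfderiv_comp r hΦ (mdifferentiableAt_extChartAt_of_mem hr)
  have h2 := mfderiv_comp r (mdifferentiableAt_extChartAt_of_mem hr')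
    (hι.mdifferentiableAt (x := r) (by simp))
  have h3 : (chartExpr m q ι p p') ∘ (extChartAt (𝓡 m) p) =ᶠ[𝓝 r] (extChartAt (𝓡 q) p') ∘ ι := by
    filter_upwards [(chartAt _ p).open_source.mem_nhds hr] with y hy
      using chartExpr_extChartAt ι p' hy
  have h4 := h3.mfderiv_eq (I := 𝓡 m) (I' := 𝓡 q)
  have h5 : (mfderiv (𝓡 m) (𝓡 q) ((extChartAt (𝓡 q) p') ∘ ι) r) v =
    (mfderiv (𝓡 m) (𝓡 q) ((chartExpr m q ι p p') ∘ (extChartAt (𝓡 m) p)) r) v := by rw [h4]; rfl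
  rw [h1, h2] at h5
  exact h5

variable [RiemannianBundle (fun x : M => TangentSpace (𝓡 m) x)]
  [RiemannianBundle (fun x : Q => TangentSpace (𝓡 q) x)]

/-- The metric of `M` is the pullback of that of `Q` under the chart expression of an isometric
immersion. -/
lemma metricForm_chartExpr {ι : M → Q} (hι : IsIsometricImmersion m q ι) {p : M} {p' : Q}
    {x : EuclideanSpace ℝ (Fin m)} (hx : x ∈ (extChartAt (𝓡 m) p).target)
    (hx' : ι ((extChartAt (𝓡 m) p).symm x) ∈ (chartAt (EuclideanSpace ℝ (Fin q)) p').source)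
    (a b : EuclideanSpace ℝ (Fin m)) :
    metricForm m p x a b = metricForm q p' (chartExpr m q ι p p' x)
      (fderiv ℝ (chartExpr m q ι p p') x a) (fderiv ℝ (chartExpr m q ι p p') x b) := by
  have hr := symm_mem_source hx
  have key : ∀ a, fderiv ℝ (chartExpr m q ι p p') x a = tangentCoord p' _
      (mfderiv (𝓡 m) (𝓡 q) ι _ (ofTangentCoord p ((extChartAt (𝓡 m) p).symm x) a)) := by
    intro a
    rw [tangentCoord_mfderiv hι.1 hr hx', tangentCoord_ofTangentCoord hr,
      (extChartAt (𝓡 m) p).right_inv hx]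
  rw [key, key, chartExpr, metricForm_tangentCoord hx', hι.2, metricForm_apply]

variable [IsContMDiffRiemannianBundle (𝓡 m) ∞ (EuclideanSpace ℝ (Fin m))
      (fun x : M => TangentSpace (𝓡 m) x)]
   [IsContMDiffRiemannianBundle (𝓡 q) ∞ (EuclideanSpace ℝ (Fin q))
      (fun x : Q => TangentSpace (𝓡 q) x)]

/-- An isometric immersion, read in charts, carries the Christoffel symbols of `M` to the tangential
part of the Hessian of the chart expression corrected by the Christoffel symbols of `Q`. -/
lemma metricForm_christoffelVec_chartExpr {ι : M → Q} (hι : IsIsometricImmersion m q ι) {p : M}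
    {p' : Q} {x : EuclideanSpace ℝ (Fin m)} (hx : x ∈ (extChartAt (𝓡 m) p).target)
    (hx' : ι ((extChartAt (𝓡 m) p).symm x) ∈ (chartAt (EuclideanSpace ℝ (Fin q)) p').source)
    (a b c : EuclideanSpace ℝ (Fin m)) :
    metricForm m p x (christoffelVec p x a b) c = metricForm q p' (chartExpr m q ι p p' x)
      (fderiv ℝ (fderiv ℝ (chartExpr m q ι p p')) x a b +
        christoffelVec p' (chartExpr m q ι p p' x) (fderiv ℝ (chartExpr m q ι p p') x a)
          (fderiv ℝ (chartExpr m q ι p p') x b))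
      (fderiv ℝ (chartExpr m q ι p p') x c) := by
  have hx'' : chartExpr m q ι p p' x ∈ (extChartAt (𝓡 q) p').target := extChartAt_mem_target hx'
  have hopen : ∀ᶠ y in 𝓝 x, y ∈ (extChartAt (𝓡 m) p).target ∧
      ι ((extChartAt (𝓡 m) p).symm y) ∈ (chartAt (EuclideanSpace ℝ (Fin q)) p').source := by
    have h2 : ContinuousAt (extChartAt (𝓡 m) p).symm x := continuousAt_extChartAt_symm'' hx
    have h3 : ContinuousAt (fun y => ι ((extChartAt (𝓡 m) p).symm y)) x :=
      ContinuousAt.comp (g := ι) hι.1.continuous.continuousAt h2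
    filter_upwards [(isOpen_extChartAt_target p).mem_nhds hx, h3.preimage_mem_nhds
      ((chartAt (EuclideanSpace ℝ (Fin q)) p').open_source.mem_nhds hx')]
    with y hy hy' using ⟨hy, hy'⟩
  rw [metricForm_christoffelVec hx, christoffelForm_pullback
    ((contDiffAt_chartExpr hι.1 hx hx').of_le ENat.LEInfty.out)
    (differentiableAt_metricForm hx) (differentiableAt_metricForm hx'') (metricForm_symm p')
    (hopen.mono fun y hy => metricForm_chartExpr hι hy.1 hy.2),
    ContinuousLinearMap.map_add, _root_.add_apply, metricForm_christoffelVec hx'', add_comm]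

section Field
variable {F : Type*} [NormedAddCommGroup F] [NormedSpace ℝ F] {H : Type*} [TopologicalSpace H]
  {J : ModelWithCorners ℝ F H} {N : Type*} [TopologicalSpace N] [ChartedSpace H N]

variable (J) in
/-- The derivative, within `s`, of a vector-valued function on the manifold `N` in the direction
`u`. It is `mfderivWithin` with values in the vector space `G` itself rather than in its tangent
space. -/
def dirDeriv {G : Type*} [NormedAddCommGroup G] [NormedSpace ℝ G] (h : N → G) (s : Set N) (z : N)
    (u : TangentSpace J z) : G :=
  mfderivWithin J 𝓘(ℝ, G) h s z u

/-- The chain rule, in a form that only asks for `k = Ψ ∘ h` near `z`. -/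
lemma dirDeriv_comp {G G' : Type*} [NormedAddCommGroup G] [NormedSpace ℝ G]
    [NormedAddCommGroup G'] [NormedSpace ℝ G'] {h : N → G} {k : N → G'} {Ψ : G → G'}
    {Ψ' : G →L[ℝ] G'} {s : Set N} {z : N} (hs : UniqueMDiffWithinAt J s z)
    (hh : MDifferentiableWithinAt J 𝓘(ℝ, G) h s z) (hΨ : HasFDerivAt Ψ Ψ' (h z))
    (hk : ∀ᶠ y in 𝓝[s] z, k y = Ψ (h y)) (hkz : k z = Ψ (h z)) (u : TangentSpace J z) :
    dirDeriv J k s z u = Ψ' (dirDeriv J h s z u) := by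
  have h1 := hΨ.hasMFDerivAt.comp_hasMFDerivWithinAt z hh.hasMFDerivWithinAt
  have h2 := (h1.congr_of_eventuallyEq hk hkz).mfderivWithin hs
  unfold dirDeriv
  rw [h2]
  rfl

lemma dirDeriv_prodMk {G G' : Type*} [NormedAddCommGroup G] [NormedSpace ℝ G]
    [NormedAddCommGroup G'] [NormedSpace ℝ G'] {h : N → G} {k : N → G'}
    {s : Set N} {z : N} (hs : UniqueMDiffWithinAt J s z)
    (hh : MDifferentiableWithinAt J 𝓘(ℝ, G) h s z) (hk : MDifferentiableWithinAt J 𝓘(ℝ, G') k s z)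
    (u : TangentSpace J z) :
    dirDeriv J (fun y => (h y, k y)) s z u = (dirDeriv J h s z u, dirDeriv J k s z u) := by
  have hp := hh.prodMk_space hk
  refine Prod.ext ?_ ?_
  · exact (dirDeriv_comp (Ψ := Prod.fst) hs hp hasFDerivAt_fst (.of_forall fun _ => rfl) rfl u).symm
  · exact (dirDeriv_comp (Ψ := Prod.snd) hs hp hasFDerivAt_snd (.of_forall fun _ => rfl) rfl u).symm

variable (J) in
omit [IsContMDiffRiemannianBundle (𝓡 m) ∞ (EuclideanSpace ℝ (Fin m))
      (fun x : M => TangentSpace (𝓡 m) x)] in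
/-- The components, in the preferred chart at `p`, of the covariant derivative of the field `W`
along `f`. Unlike in `covDeriv`, the chart is arbitrary. -/
def chartCovDeriv (p : M) (f : N → M) (s : Set N) (W : ∀ z : N, TangentSpace (𝓡 m) (f z)) (z : N)
    (u : TangentSpace J z) : EuclideanSpace ℝ (Fin m) :=
  dirDeriv J (fun y => tangentCoord p (f y) (W y)) s z u +
    christoffelVec p (extChartAt (𝓡 m) p (f z))
      (dirDeriv J (fun y => extChartAt (𝓡 m) p (f y)) s z u) (tangentCoord p (f z) (W z))

omit [IsContMDiffRiemannianBundle (𝓡 m) ∞ (EuclideanSpace ℝ (Fin m))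
      (fun x : M => TangentSpace (𝓡 m) x)] in
lemma covDeriv_eq_chartCovDeriv (f : N → M) (s : Set N) (W : ∀ z : N, TangentSpace (𝓡 m) (f z))
    (z : N) (u : TangentSpace J z) : covDeriv J f s W z u =
      ofTangentCoord (f z) (f z) (chartCovDeriv J (f z) f s W z u) := rfl

variable {f : N → M} {s : Set N} {W : ∀ z : N, TangentSpace (𝓡 m) (f z)} {z : N}

omit [IsContMDiffRiemannianBundle (𝓡 m) ∞ (EuclideanSpace ℝ (Fin m))
      (fun x : M => TangentSpace (𝓡 m) x)]
   [IsContMDiffRiemannianBundle (𝓡 q) ∞ (EuclideanSpace ℝ (Fin q))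
      (fun x : Q => TangentSpace (𝓡 q) x)]
  [RiemannianBundle (fun x : M => TangentSpace (𝓡 m) x)] in
/-- The covariant derivative of the push-forward of a field `W` by `ι`, in charts, by the chain
rule. The first summand is tangential; the remaining two depend on `W` only through its value at
`z`. -/
lemma chartCovDeriv_mfderiv {ι : M → Q} (hι : ContMDiff (𝓡 m) (𝓡 q) ∞ ι) {p : M} {p' : Q}
    (hz : f z ∈ (chartAt (EuclideanSpace ℝ (Fin m)) p).source)
    (hz' : ι (f z) ∈ (chartAt (EuclideanSpace ℝ (Fin q)) p').source)
    (hs : UniqueMDiffWithinAt J s z)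
    (hW : ContMDiffWithinAt J (𝓡 m).tangent ∞ (fun y => (⟨f y, W y⟩ : TangentBundle (𝓡 m) M)) s z)
    (u : TangentSpace J z) :
    chartCovDeriv J p' (fun y => ι (f y)) s (fun y => mfderiv (𝓡 m) (𝓡 q) ι (f y) (W y)) z u =
      fderiv ℝ (chartExpr m q ι p p') (extChartAt (𝓡 m) p (f z))
        (dirDeriv J (fun y => tangentCoord p (f y) (W y)) s z u) +
      (fderiv ℝ (fderiv ℝ (chartExpr m q ι p p')) (extChartAt (𝓡 m) p (f z))
        (dirDeriv J (fun y => extChartAt (𝓡 m) p (f y)) s z u)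
        (tangentCoord p (f z) (W z)) +
      christoffelVec p' (chartExpr m q ι p p' (extChartAt (𝓡 m) p (f z)))
        (fderiv ℝ (chartExpr m q ι p p') (extChartAt (𝓡 m) p (f z))
          (dirDeriv J (fun y => extChartAt (𝓡 m) p (f y)) s z u))
        (fderiv ℝ (chartExpr m q ι p p') (extChartAt (𝓡 m) p (f z))
          (tangentCoord p (f z) (W z)))) := by
  set Φ := chartExpr m q ι p p' with hΦdef
  obtain ⟨hf, hw⟩ := (contMDiffWithinAt_field_iff hz).1 hW
  have hx := contMDiffWithinAt_extChartAt_comp hz hf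
  have hΦ : ContDiffAt ℝ ∞ Φ (extChartAt (𝓡 m) p (f z)) :=
    contDiffAt_chartExpr_extChartAt hι hz hz'
  have hev : ∀ᶠ y in 𝓝[s] z, f y ∈ (chartAt (EuclideanSpace ℝ (Fin m)) p).source ∧
      ι (f y) ∈ (chartAt (EuclideanSpace ℝ (Fin q)) p').source :=
    Filter.Eventually.and (hf.continuousWithinAt ((chartAt _ p).open_source.mem_nhds hz))
      ((hι.continuous.continuousAt.comp_continuousWithinAt hf.continuousWithinAt)
        ((chartAt _ p').open_source.mem_nhds hz'))
  have hx1 := (hx.mdifferentiableWithinAt (by simp))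
  have hw1 := (hw.mdifferentiableWithinAt (by simp))
  have hΦ1 := (hΦ.differentiableAt (by simp)).hasFDerivAt
  have hΦ2 := ((hΦ.fderiv_right (m := ∞) (by simp)).differentiableAt (by simp)).hasFDerivAt
  have e1 : dirDeriv J (fun y => extChartAt (𝓡 q) p' (ι (f y))) s z u =
      fderiv ℝ Φ (extChartAt (𝓡 m) p (f z))
        (dirDeriv J (fun y => extChartAt (𝓡 m) p (f y)) s z u) := by
    refine dirDeriv_comp hs hx1 hΦ1 ?_ (chartExpr_extChartAt ι p' hz).symm u
    filter_upwards [hev] with y hy using (chartExpr_extChartAt ι p' hy.1).symm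
  have e2 : dirDeriv J (fun y => tangentCoord p' (ι (f y))
        (mfderiv (𝓡 m) (𝓡 q) ι (f y) (W y))) s z u =
      fderiv ℝ Φ (extChartAt (𝓡 m) p (f z))
        (dirDeriv J (fun y => tangentCoord p (f y) (W y)) s z u) +
      fderiv ℝ (fderiv ℝ Φ) (extChartAt (𝓡 m) p (f z))
        (dirDeriv J (fun y => extChartAt (𝓡 m) p (f y)) s z u)
        (tangentCoord p (f z) (W z)) := by
    have h0 : HasFDerivAt (fun y : EuclideanSpace ℝ (Fin m) × EuclideanSpace ℝ (Fin m) =>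
        fderiv ℝ Φ y.1 y.2) _ (extChartAt (𝓡 m) p (f z), tangentCoord p (f z) (W z)) :=
      (HasFDerivAt.comp (g := fderiv ℝ Φ) (f := Prod.fst)
        (extChartAt (𝓡 m) p (f z), tangentCoord p (f z) (W z)) hΦ2 hasFDerivAt_fst).clm_apply
        hasFDerivAt_snd
    rw [dirDeriv_comp hs (hx1.prodMk_space hw1) h0 ?_ (tangentCoord_mfderiv hι hz hz' (W z)) u,
      dirDeriv_prodMk hs hx1 hw1]
    · rfl
    · filter_upwards [hev] with y hy using tangentCoord_mfderiv hι hy.1 hy.2 (W y)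
  rw [chartCovDeriv, e1, e2, tangentCoord_mfderiv hι hz hz', ← chartExpr_extChartAt ι p' hz,
    add_assoc]

/-- The tangential part of the covariant derivative of the push-forward of `W` is the push-forward
of the covariant derivative of `W`, in arbitrary charts of `M` and `Q`. -/
lemma metricForm_chartCovDeriv {ι : M → Q} (hι : IsIsometricImmersion m q ι) {p : M} {p' : Q}
    (hz : f z ∈ (chartAt (EuclideanSpace ℝ (Fin m)) p).source)
    (hz' : ι (f z) ∈ (chartAt (EuclideanSpace ℝ (Fin q)) p').source)
    (hs : UniqueMDiffWithinAt J s z)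
    (hW : ContMDiffWithinAt J (𝓡 m).tangent ∞ (fun y => (⟨f y, W y⟩ : TangentBundle (𝓡 m) M)) s z)
    (u : TangentSpace J z) (c : EuclideanSpace ℝ (Fin m)) :
    metricForm q p' (extChartAt (𝓡 q) p' (ι (f z)))
      (chartCovDeriv J p' (fun y => ι (f y)) s (fun y => mfderiv (𝓡 m) (𝓡 q) ι (f y) (W y)) z u)
      (fderiv ℝ (chartExpr m q ι p p') (extChartAt (𝓡 m) p (f z)) c) =
    metricForm m p (extChartAt (𝓡 m) p (f z)) (chartCovDeriv J p f s W z u) c := by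
  have hx := extChartAt_mem_target hz
  have hx' : ι ((extChartAt (𝓡 m) p).symm (extChartAt (𝓡 m) p (f z))) ∈
      (chartAt (EuclideanSpace ℝ (Fin q)) p').source := by
    rwa [(extChartAt (𝓡 m) p).left_inv (by rwa [extChartAt_source])]
  have h := metricForm_christoffelVec_chartExpr hι hx hx'
    (dirDeriv J (fun y => extChartAt (𝓡 m) p (f y)) s z u) (tangentCoord p (f z) (W z)) c
  rw [chartCovDeriv_mfderiv hι.1 hz hz' hs hW, chartCovDeriv, ← chartExpr_extChartAt ι p' hz,
    ContinuousLinearMap.map_add, ContinuousLinearMap.map_add (metricForm m p _), _root_.add_apply,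
    _root_.add_apply, h, metricForm_chartExpr hι hx hx']

end Field
end ChartExpr

/-! ### Chart independence and compatibility with the metric -/

/-- The product rule for the value of a bilinear form at two variable vectors. -/
lemma exists_hasFDerivAt_form {E : Type*} [NormedAddCommGroup E] [NormedSpace ℝ E]
    {g : E → E →L[ℝ] E →L[ℝ] ℝ} {x : E} (hg : DifferentiableAt ℝ g x) (v w : E) :
    ∃ L : E × E × E →L[ℝ] ℝ, HasFDerivAt (fun y : E × E × E => g y.1 y.2.1 y.2.2) L (x, v, w) ∧
      ∀ d, L d = fderiv ℝ g x d.1 v w + g x d.2.1 w + g x v d.2.2 := by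
  have hfst : HasFDerivAt (fun y : E × E × E => y.1) (ContinuousLinearMap.fst ℝ E (E × E))
      (x, v, w) := hasFDerivAt_fst
  have h0 := HasFDerivAt.comp (g := g) (x, v, w) hg.hasFDerivAt hfst
  refine ⟨_, (h0.clm_apply hasFDerivAt_snd.fst).clm_apply hasFDerivAt_snd.snd, fun d => ?_⟩
  simp
  ring

section CovDeriv
variable {m q : ℕ} {M : Type*} [TopologicalSpace M] [ChartedSpace (EuclideanSpace ℝ (Fin m)) M]
  [IsManifold (𝓡 m) ∞ M]
  [RiemannianBundle (fun x : M => TangentSpace (𝓡 m) x)]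
  {Q : Type*} [TopologicalSpace Q] [ChartedSpace (EuclideanSpace ℝ (Fin q)) Q]
  [IsManifold (𝓡 q) ∞ Q]
  [RiemannianBundle (fun x : Q => TangentSpace (𝓡 q) x)]
  {F : Type*} [NormedAddCommGroup F] [NormedSpace ℝ F] {H : Type*} [TopologicalSpace H]
  {J : ModelWithCorners ℝ F H} {N : Type*} [TopologicalSpace N] [ChartedSpace H N]
  {f : N → M} {s : Set N} {W V : ∀ z : N, TangentSpace (𝓡 m) (f z)} {z : N}

lemma metricForm_eq_inner_ofTangentCoord {p r : M}
    (h : r ∈ (chartAt (EuclideanSpace ℝ (Fin m)) p).source) (a : EuclideanSpace ℝ (Fin m))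
    (v : TangentSpace (𝓡 m) r) :
    metricForm m p (extChartAt (𝓡 m) p r) a (tangentCoord p r v) =
      inner ℝ (ofTangentCoord p r a) v := by
  rw [← metricForm_tangentCoord h, tangentCoord_ofTangentCoord h]

omit [RiemannianBundle (fun x : M => TangentSpace (𝓡 m) x)] in
lemma dirDeriv_extChartAt_comp {p : M}
    (hz : f z ∈ (chartAt (EuclideanSpace ℝ (Fin m)) p).source) (hs : UniqueMDiffWithinAt J s z)
    (hf : MDifferentiableWithinAt J (𝓡 m) f s z) (u : TangentSpace J z) :
    dirDeriv J (fun y => extChartAt (𝓡 m) p (f y)) s z u =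
      tangentCoord p (f z) (mfderivWithin J (𝓡 m) f s z u) := by
  rw [tangentCoord_eq_mfderiv hz, dirDeriv]
  have h := mfderiv_comp_mfderivWithin z (mdifferentiableAt_extChartAt_of_mem hz) hf hs
  exact congrArg (fun L : TangentSpace J z →L[ℝ] EuclideanSpace ℝ (Fin m) => L u) h

lemma dirDeriv_eq_zero {G : Type*} [NormedAddCommGroup G] [NormedSpace ℝ G] {h : N → G} {a : G}
    (hs : UniqueMDiffWithinAt J s z) (hh : ∀ᶠ y in 𝓝[s] z, h y = a) (hz : h z = a)
    (u : TangentSpace J z) : dirDeriv J h s z u = 0 := by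
  rw [dirDeriv_comp (h := fun _ => (0 : G)) (Ψ := fun _ => a) hs mdifferentiableWithinAt_const
    (hasFDerivAt_const a _) hh hz]
  rfl

omit [IsManifold (𝓡 m) ∞ M] in
lemma isIsometricImmersion_id : IsIsometricImmersion m m (fun r : M => r) :=
  ⟨contMDiff_id, fun p u v => by
    change inner ℝ (mfderiv (𝓡 m) (𝓡 m) id p u) (mfderiv (𝓡 m) (𝓡 m) id p v) = inner ℝ u v
    rw [mfderiv_id]; rfl⟩

variable [IsContMDiffRiemannianBundle (𝓡 m) ∞ (EuclideanSpace ℝ (Fin m))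
      (fun x : M => TangentSpace (𝓡 m) x)]

/-- The covariant derivative does not depend on the chart: the identity map of `M` is an isometric
immersion, read in the charts at `p` and `p'`. -/
lemma ofTangentCoord_chartCovDeriv {p p' : M}
    (hz : f z ∈ (chartAt (EuclideanSpace ℝ (Fin m)) p).source)
    (hz' : f z ∈ (chartAt (EuclideanSpace ℝ (Fin m)) p').source)
    (hs : UniqueMDiffWithinAt J s z)
    (hW : ContMDiffWithinAt J (𝓡 m).tangent ∞ (fun y => (⟨f y, W y⟩ : TangentBundle (𝓡 m) M)) s z)
    (u : TangentSpace J z) :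
    ofTangentCoord p' (f z) (chartCovDeriv J p' f s W z u) =
      ofTangentCoord p (f z) (chartCovDeriv J p f s W z u) := by
  refine ext_inner_right ℝ fun v => ?_
  have h := metricForm_chartCovDeriv isIsometricImmersion_id hz hz' hs hW u (tangentCoord p (f z) v)
  rw [← tangentCoord_mfderiv (isIsometricImmersion_id (m := m) (M := M)).1 hz hz'] at h
  have hid : ∀ (r : M) (v : TangentSpace (𝓡 m) r),
      mfderiv (𝓡 m) (𝓡 m) (fun r : M => r) r v = v := by
    intro r v
    change mfderiv (𝓡 m) (𝓡 m) id r v = v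
    rw [mfderiv_id]; rfl
  have hW' : (fun y => mfderiv (𝓡 m) (𝓡 m) (fun r : M => r) (f y) (W y)) = W :=
    funext fun y => hid _ _
  rw [hW', hid, metricForm_eq_inner_ofTangentCoord hz', metricForm_eq_inner_ofTangentCoord hz] at h
  exact h

lemma covDeriv_eq_ofTangentCoord {p : M}
    (hz : f z ∈ (chartAt (EuclideanSpace ℝ (Fin m)) p).source)
    (hs : UniqueMDiffWithinAt J s z)
    (hW : ContMDiffWithinAt J (𝓡 m).tangent ∞ (fun y => (⟨f y, W y⟩ : TangentBundle (𝓡 m) M)) s z)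
    (u : TangentSpace J z) :
    covDeriv J f s W z u = ofTangentCoord p (f z) (chartCovDeriv J p f s W z u) :=
  ofTangentCoord_chartCovDeriv hz (mem_chart_source _ _) hs hW u

lemma tangentCoord_covDeriv {p : M}
    (hz : f z ∈ (chartAt (EuclideanSpace ℝ (Fin m)) p).source)
    (hs : UniqueMDiffWithinAt J s z)
    (hW : ContMDiffWithinAt J (𝓡 m).tangent ∞ (fun y => (⟨f y, W y⟩ : TangentBundle (𝓡 m) M)) s z)
    (u : TangentSpace J z) :
    tangentCoord p (f z) (covDeriv J f s W z u) = chartCovDeriv J p f s W z u := by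
  rw [covDeriv_eq_ofTangentCoord hz hs hW, tangentCoord_ofTangentCoord hz]

/-- The connection along a map is compatible with the metric. -/
lemma dirDeriv_inner (hs : UniqueMDiffWithinAt J s z)
    (hW : ContMDiffWithinAt J (𝓡 m).tangent ∞ (fun y => (⟨f y, W y⟩ : TangentBundle (𝓡 m) M)) s z)
    (hV : ContMDiffWithinAt J (𝓡 m).tangent ∞ (fun y => (⟨f y, V y⟩ : TangentBundle (𝓡 m) M)) s z)
    (u : TangentSpace J z) :
    dirDeriv J (fun y => inner ℝ (W y) (V y)) s z u =
      inner ℝ (covDeriv J f s W z u) (V z) + inner ℝ (W z) (covDeriv J f s V z u) := by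
  set p := f z
  have hz : f z ∈ (chartAt (EuclideanSpace ℝ (Fin m)) p).source := mem_chart_source _ _
  obtain ⟨hf, hw⟩ := (contMDiffWithinAt_field_iff hz).1 hW
  obtain ⟨-, hv⟩ := (contMDiffWithinAt_field_iff hz).1 hV
  have hx1 := (contMDiffWithinAt_extChartAt_comp hz hf).mdifferentiableWithinAt (by simp)
  have hw1 := hw.mdifferentiableWithinAt (by simp)
  have hv1 := hv.mdifferentiableWithinAt (by simp)
  have hxt := extChartAt_mem_target hz
  have hev : ∀ᶠ y in 𝓝[s] z, f y ∈ (chartAt (EuclideanSpace ℝ (Fin m)) p).source :=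
    hf.continuousWithinAt ((chartAt _ p).open_source.mem_nhds hz)
  obtain ⟨L, hL, hL'⟩ := exists_hasFDerivAt_form (differentiableAt_metricForm hxt)
    (tangentCoord p (f z) (W z)) (tangentCoord p (f z) (V z))
  rw [dirDeriv_comp hs (hx1.prodMk_space (hw1.prodMk_space hv1)) hL ?_
    (metricForm_tangentCoord hz _ _).symm u, dirDeriv_prodMk hs hx1 (hw1.prodMk_space hv1),
    dirDeriv_prodMk hs hw1 hv1, hL', ← metricForm_tangentCoord hz, ← metricForm_tangentCoord hz,
    tangentCoord_covDeriv hz hs hW, tangentCoord_covDeriv hz hs hV]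
  · have hc := christoffelForm_add_swap (differentiableAt_metricForm hxt) (metricForm_symm p)
      (dirDeriv J (fun y => extChartAt (𝓡 m) p (f y)) s z u) (tangentCoord p (f z) (W z))
      (tangentCoord p (f z) (V z))
    rw [chartCovDeriv, chartCovDeriv, ContinuousLinearMap.map_add, ContinuousLinearMap.map_add,
      _root_.add_apply, metricForm_symm p _ (tangentCoord p (f z) (W z)) (christoffelVec _ _ _ _),
      metricForm_christoffelVec hxt, metricForm_christoffelVec hxt, ← hc]
    ring
  · filter_upwards [hev] with y hy using (metricForm_tangentCoord hy _ _).symm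

end CovDeriv

/-! ### The normal space and the Gauss formula -/

section NormalSpace
variable {m q : ℕ} {M : Type*} [TopologicalSpace M] [ChartedSpace (EuclideanSpace ℝ (Fin m)) M]
  {Q : Type*} [TopologicalSpace Q] [ChartedSpace (EuclideanSpace ℝ (Fin q)) Q]
  [RiemannianBundle (fun x : Q => TangentSpace (𝓡 q) x)] {ι : M → Q}

lemma mem_normalSpace_iff {p : M} {ξ : TangentSpace (𝓡 q) (ι p)} :
    ξ ∈ normalSpace m q ι p ↔ ∀ v, inner ℝ (mfderiv (𝓡 m) (𝓡 q) ι p v) ξ = 0 := by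
  rw [normalSpace, Submodule.mem_orthogonal]
  constructor
  · exact fun h v => h _ ⟨v, rfl⟩
  · rintro h _ ⟨v, rfl⟩
    exact h v

lemma inner_mfderiv_of_mem_normalSpace {p : M} (v : TangentSpace (𝓡 m) p)
    {ξ : TangentSpace (𝓡 q) (ι p)} (hξ : ξ ∈ normalSpace m q ι p) :
    inner ℝ (mfderiv (𝓡 m) (𝓡 q) ι p v) ξ = 0 := mem_normalSpace_iff.1 hξ v

lemma normalProj_mfderiv {p : M} (v : TangentSpace (𝓡 m) p) :
    normalProj m q ι p (mfderiv (𝓡 m) (𝓡 q) ι p v) = 0 := by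
  rw [normalProj, Submodule.starProjection_apply_eq_zero_iff]
  exact Submodule.le_orthogonal_orthogonal _ ⟨v, rfl⟩

lemma normalProj_add {p : M} (v w : TangentSpace (𝓡 q) (ι p)) :
    normalProj m q ι p (v + w) = normalProj m q ι p v + normalProj m q ι p w := map_add _ v w

lemma normalProj_sub {p : M} (v w : TangentSpace (𝓡 q) (ι p)) :
    normalProj m q ι p (v - w) = normalProj m q ι p v - normalProj m q ι p w := map_sub _ v w

lemma normalProj_eq_self {p : M} {ξ : TangentSpace (𝓡 q) (ι p)} (h : ξ ∈ normalSpace m q ι p) :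
    normalProj m q ι p ξ = ξ := Submodule.starProjection_eq_self_iff.2 h

lemma normalProj_mem {p : M} (ξ : TangentSpace (𝓡 q) (ι p)) :
    normalProj m q ι p ξ ∈ normalSpace m q ι p := Submodule.starProjection_apply_mem _ _

lemma norm_mfderiv [RiemannianBundle (fun x : M => TangentSpace (𝓡 m) x)]
    (hι : IsIsometricImmersion m q ι) {p : M} (v : TangentSpace (𝓡 m) p) :
    ‖mfderiv (𝓡 m) (𝓡 q) ι p v‖ = ‖v‖ := by
  rw [norm_eq_sqrt_real_inner (mfderiv (𝓡 m) (𝓡 q) ι p v), hι.2, ← norm_eq_sqrt_real_inner]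

end NormalSpace

section Gauss
variable {m q : ℕ} {M : Type*} [TopologicalSpace M] [ChartedSpace (EuclideanSpace ℝ (Fin m)) M]
  [IsManifold (𝓡 m) ∞ M]
  [RiemannianBundle (fun x : M => TangentSpace (𝓡 m) x)]
  {Q : Type*} [TopologicalSpace Q] [ChartedSpace (EuclideanSpace ℝ (Fin q)) Q]
  [IsManifold (𝓡 q) ∞ Q]
  [RiemannianBundle (fun x : Q => TangentSpace (𝓡 q) x)]
  {F : Type*} [NormedAddCommGroup F] [NormedSpace ℝ F] {H : Type*} [TopologicalSpace H]
  {J : ModelWithCorners ℝ F H} {N : Type*} [TopologicalSpace N] [ChartedSpace H N]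
  {f : N → M} {s : Set N} {W : ∀ z : N, TangentSpace (𝓡 m) (f z)} {z : N}
  {ι : M → Q}

omit [RiemannianBundle (fun x : M => TangentSpace (𝓡 m) x)] in
/-- The normal part of the ambient derivative of a tangent field along `f` is the second fundamental
form, whose definition uses the particular extension with constant components. -/
lemma normalProj_covDeriv_mfderiv (hι : ContMDiff (𝓡 m) (𝓡 q) ∞ ι)
    (hs : UniqueMDiffWithinAt J s z)
    (hW : ContMDiffWithinAt J (𝓡 m).tangent ∞ (fun y => (⟨f y, W y⟩ : TangentBundle (𝓡 m) M)) s z)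
    (u : TangentSpace J z) :
    normalProj m q ι (f z) (covDeriv J (fun y => ι (f y)) s
      (fun y => mfderiv (𝓡 m) (𝓡 q) ι (f y) (W y)) z u) =
    secondFundamentalForm m q ι (f z) (mfderivWithin J (𝓡 m) f s z u) (W z) := by
  -- both sides are computed in the same charts; the terms that distinguish the field `W` from the
  -- field with constant components are tangential
  set p := f z
  have hz : f z ∈ (chartAt (EuclideanSpace ℝ (Fin m)) p).source := mem_chart_source _ _
  have hz' : ι (f z) ∈ (chartAt (EuclideanSpace ℝ (Fin q)) (ι p)).source := mem_chart_source _ _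
  obtain ⟨hf, -⟩ := (contMDiffWithinAt_field_iff hz).1 hW
  have hX := (contMDiffAt_ofTangentCoord hz (tangentCoord p p (W z)))
  have hu := uniqueMDiffWithinAt_univ (𝓡 m) (x := p)
  rw [secondFundamentalForm, covDeriv_eq_chartCovDeriv, chartCovDeriv_mfderiv hι hz hz' hs hW,
    covDeriv_eq_chartCovDeriv, chartCovDeriv_mfderiv (f := fun r : M => r) (s := Set.univ) hι hz hz'
      hu hX,
    dirDeriv_extChartAt_comp hz hs (hf.mdifferentiableWithinAt (by simp)),
    dirDeriv_extChartAt_comp (f := fun r : M => r) hz hu mdifferentiableWithinAt_id,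
    dirDeriv_eq_zero (h := fun y => tangentCoord p y (ofTangentCoord p y (tangentCoord p p (W z))))
      hu _ (tangentCoord_ofTangentCoord hz _), ContinuousLinearMap.map_zero, zero_add,
    ofTangentCoord_add, normalProj_add]
  · have h1 : ∀ w, normalProj m q ι p (ofTangentCoord (ι p) (ι p)
        (fderiv ℝ (chartExpr m q ι p (ι p)) (extChartAt (𝓡 m) p p) w)) = 0 := by
      intro w
      rw [← tangentCoord_ofTangentCoord (mem_chart_source _ p) w,
        ← tangentCoord_mfderiv hι (mem_chart_source _ _) (mem_chart_source _ _),
        ofTangentCoord_tangentCoord (mem_chart_source _ _), normalProj_mfderiv]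
    have h2 : ∀ w : TangentSpace (𝓡 m) p,
        mfderivWithin (𝓡 m) (𝓡 m) (fun r : M => r) Set.univ p w = w := by
      intro w
      rw [mfderivWithin_univ]
      change mfderiv (𝓡 m) (𝓡 m) id p w = w
      rw [mfderiv_id]; rfl
    rw [h1, zero_add, h2, ofTangentCoord_tangentCoord hz]
  · filter_upwards [mem_nhdsWithin_of_mem_nhds ((chartAt _ p).open_source.mem_nhds hz)] with y hy
      using tangentCoord_ofTangentCoord hy _

variable [IsContMDiffRiemannianBundle (𝓡 m) ∞ (EuclideanSpace ℝ (Fin m))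
      (fun x : M => TangentSpace (𝓡 m) x)]
   [IsContMDiffRiemannianBundle (𝓡 q) ∞ (EuclideanSpace ℝ (Fin q))
      (fun x : Q => TangentSpace (𝓡 q) x)]

/-- The tangential part of the ambient covariant derivative is the intrinsic one. -/
lemma inner_covDeriv_mfderiv (hι : IsIsometricImmersion m q ι)
    (hs : UniqueMDiffWithinAt J s z)
    (hW : ContMDiffWithinAt J (𝓡 m).tangent ∞ (fun y => (⟨f y, W y⟩ : TangentBundle (𝓡 m) M)) s z)
    (u : TangentSpace J z) (v : TangentSpace (𝓡 m) (f z)) :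
    inner ℝ (covDeriv J (fun y => ι (f y)) s
      (fun y => mfderiv (𝓡 m) (𝓡 q) ι (f y) (W y)) z u) (mfderiv (𝓡 m) (𝓡 q) ι (f z) v) =
    inner ℝ (covDeriv J f s W z u) v := by
  have hz : f z ∈ (chartAt (EuclideanSpace ℝ (Fin m)) (f z)).source := mem_chart_source _ _
  have hz' : ι (f z) ∈ (chartAt (EuclideanSpace ℝ (Fin q)) (ι (f z))).source := mem_chart_source _ _
  have h := metricForm_chartCovDeriv hι hz hz' hs hW u (tangentCoord (f z) (f z) v)
  rw [← tangentCoord_mfderiv hι.1 hz hz', metricForm_eq_inner_ofTangentCoord hz,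
    metricForm_eq_inner_ofTangentCoord hz'] at h
  exact h

/-- The **Gauss formula** for tangent fields along a map `f` into `M`. -/
lemma covDeriv_mfderiv (hι : IsIsometricImmersion m q ι)
    (hs : UniqueMDiffWithinAt J s z)
    (hW : ContMDiffWithinAt J (𝓡 m).tangent ∞ (fun y => (⟨f y, W y⟩ : TangentBundle (𝓡 m) M)) s z)
    (u : TangentSpace J z) :
    covDeriv J (fun y => ι (f y)) s (fun y => mfderiv (𝓡 m) (𝓡 q) ι (f y) (W y)) z u =
    mfderiv (𝓡 m) (𝓡 q) ι (f z) (covDeriv J f s W z u) +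
    secondFundamentalForm m q ι (f z) (mfderivWithin J (𝓡 m) f s z u) (W z) := by
  set X := covDeriv J (fun y => ι (f y)) s (fun y => mfderiv (𝓡 m) (𝓡 q) ι (f y) (W y)) z u with hX
  have h1 : X - mfderiv (𝓡 m) (𝓡 q) ι (f z) (covDeriv J f s W z u) ∈ normalSpace m q ι (f z) := by
    rw [mem_normalSpace_iff]
    intro v
    rw [real_inner_comm, inner_sub_left, hX, inner_covDeriv_mfderiv hι hs hW, hι.2, sub_self]
  have h2 := normalProj_eq_self h1
  rw [normalProj_sub, normalProj_mfderiv, sub_zero, hX, normalProj_covDeriv_mfderiv hι.1 hs hW,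
    ← hX] at h2
  rw [h2]
  abel

omit [IsContMDiffRiemannianBundle (𝓡 m) ∞ (EuclideanSpace ℝ (Fin m))
      (fun x : M => TangentSpace (𝓡 m) x)]
   [IsContMDiffRiemannianBundle (𝓡 q) ∞ (EuclideanSpace ℝ (Fin q))
      (fun x : Q => TangentSpace (𝓡 q) x)] [RiemannianBundle (fun x : M => TangentSpace (𝓡 m) x)]
  [IsManifold (𝓡 m) ∞ M] in
/-- The chain rule: the covariant derivative along `ι ∘ f` of the restriction of a field along `ι`.
-/
lemma covDeriv_comp {ξ : ∀ r : M, TangentSpace (𝓡 q) (ι r)}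
    (hs : UniqueMDiffWithinAt J s z) (hf : MDifferentiableWithinAt J (𝓡 m) f s z)
    (hξ : ContMDiffAt (𝓡 m) (𝓡 q).tangent ∞ (fun r => (⟨ι r, ξ r⟩ : TangentBundle (𝓡 q) Q)) (f z))
    (u : TangentSpace J z) :
    covDeriv J (fun y => ι (f y)) s (fun y => ξ (f y)) z u =
      covDeriv (𝓡 m) ι Set.univ ξ (f z) (mfderivWithin J (𝓡 m) f s z u) := by
  have hz' : ι (f z) ∈ (chartAt (EuclideanSpace ℝ (Fin q)) (ι (f z))).source := mem_chart_source _ _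
  obtain ⟨h1, h2⟩ := (contMDiffWithinAt_field_iff (s := Set.univ) hz').1 hξ
  have h3 := contMDiffWithinAt_extChartAt_comp hz' h1
  have key : ∀ h : M → EuclideanSpace ℝ (Fin q), MDifferentiableAt (𝓡 m) (𝓡 q) h (f z) →
      dirDeriv J (fun y => h (f y)) s z u =
        dirDeriv (𝓡 m) h Set.univ (f z) (mfderivWithin J (𝓡 m) f s z u) := by
    intro h hh
    have := mfderiv_comp_mfderivWithin z hh hf hs
    rw [dirDeriv, dirDeriv, mfderivWithin_univ]
    exact congrArg (fun L : TangentSpace J z →L[ℝ] EuclideanSpace ℝ (Fin q) => L u) this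
  rw [covDeriv_eq_chartCovDeriv, covDeriv_eq_chartCovDeriv, chartCovDeriv, chartCovDeriv,
    key (fun r => tangentCoord (ι (f z)) (ι r) (ξ r)),
    key (fun r => extChartAt (𝓡 q) (ι (f z)) (ι r))]
  · exact (h3.mdifferentiableWithinAt (by simp)).mdifferentiableAt Filter.univ_mem
  · exact (h2.mdifferentiableWithinAt (by simp)).mdifferentiableAt Filter.univ_mem

end Gauss

/-! ### The second fundamental form of a totally umbilic immersion -/

section Umbilic
variable {m q : ℕ} {M : Type*} [TopologicalSpace M] [ChartedSpace (EuclideanSpace ℝ (Fin m)) M]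
  [IsManifold (𝓡 m) ∞ M]
  [RiemannianBundle (fun x : M => TangentSpace (𝓡 m) x)]
  {Q : Type*} [TopologicalSpace Q] [ChartedSpace (EuclideanSpace ℝ (Fin q)) Q]
  [IsManifold (𝓡 q) ∞ Q]
  [RiemannianBundle (fun x : Q => TangentSpace (𝓡 q) x)]
  {ι : M → Q}

lemma christoffelVec_add_right (p : M) (x a b b' : EuclideanSpace ℝ (Fin m)) :
    christoffelVec p x a (b + b') = christoffelVec p x a b + christoffelVec p x a b' := by
  ext k
  simp [christoffelVec, mul_add, Finset.sum_add_distrib]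

lemma christoffelVec_smul_right (p : M) (r : ℝ) (x a b : EuclideanSpace ℝ (Fin m)) :
    christoffelVec p x a (r • b) = r • christoffelVec p x a b := by
  ext k
  simp only [christoffelVec, PiLp.smul_apply, smul_eq_mul, Finset.mul_sum]
  refine Finset.sum_congr rfl fun i _ => Finset.sum_congr rfl fun j _ => ?_
  ring

omit [RiemannianBundle (fun x : M => TangentSpace (𝓡 m) x)] in
lemma secondFundamentalForm_mem (p : M) (u v : TangentSpace (𝓡 m) p) :
    secondFundamentalForm m q ι p u v ∈ normalSpace m q ι p := normalProj_mem _

lemma meanCurvature_mem (p : M) : meanCurvature m q ι p ∈ normalSpace m q ι p :=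
  Submodule.smul_mem _ _ (Submodule.sum_mem _ fun _ _ => secondFundamentalForm_mem p _ _)

/-- In dimension zero the trace is an empty sum, so that a nonzero `H` forces positive dimension. -/
lemma dim_ne_zero_of_meanCurvature_ne_zero {p : M} (h : meanCurvature m q ι p ≠ 0) : m ≠ 0 := by
  rintro rfl
  simp [meanCurvature] at h

variable (m q) in
/-- The components of the second fundamental form, in the preferred charts at `p` and `p'`: the
Hessian of the chart expression of `ι`, corrected by the Christoffel symbols of both manifolds. -/
def chartSecondForm (ι : M → Q) (p : M) (p' : Q) (x a b : EuclideanSpace ℝ (Fin m)) :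
    EuclideanSpace ℝ (Fin q) :=
  fderiv ℝ (fderiv ℝ (chartExpr m q ι p p')) x a b +
    christoffelVec p' (chartExpr m q ι p p' x) (fderiv ℝ (chartExpr m q ι p p') x a)
      (fderiv ℝ (chartExpr m q ι p p') x b) -
    fderiv ℝ (chartExpr m q ι p p') x (christoffelVec p x a b)

variable [IsContMDiffRiemannianBundle (𝓡 m) ∞ (EuclideanSpace ℝ (Fin m))
      (fun x : M => TangentSpace (𝓡 m) x)]
   [IsContMDiffRiemannianBundle (𝓡 q) ∞ (EuclideanSpace ℝ (Fin q))
      (fun x : Q => TangentSpace (𝓡 q) x)]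

lemma tangentCoord_secondFundamentalForm (hι : IsIsometricImmersion m q ι) {p r : M} {p' : Q}
    (hr : r ∈ (chartAt (EuclideanSpace ℝ (Fin m)) p).source)
    (hr' : ι r ∈ (chartAt (EuclideanSpace ℝ (Fin q)) p').source) (u v : TangentSpace (𝓡 m) r) :
    tangentCoord p' (ι r) (secondFundamentalForm m q ι r u v) =
      chartSecondForm m q ι p p' (extChartAt (𝓡 m) p r) (tangentCoord p r u)
        (tangentCoord p r v) := by
  have hX := contMDiffAt_ofTangentCoord hr (tangentCoord p r v)
  have hu := uniqueMDiffWithinAt_univ (𝓡 m) (x := r)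
  have hid : mfderivWithin (𝓡 m) (𝓡 m) (fun r : M => r) Set.univ r u = u := by
    rw [mfderivWithin_univ]
    change mfderiv (𝓡 m) (𝓡 m) id r u = u
    rw [mfderiv_id]; rfl
  have hιX : ContMDiffWithinAt (𝓡 m) (𝓡 q).tangent ∞ (fun y => (⟨ι y, mfderiv (𝓡 m) (𝓡 q) ι y
      (ofTangentCoord p y (tangentCoord p r v))⟩ : TangentBundle (𝓡 q) Q)) Set.univ r :=
    ((hι.1.contMDiff_tangentMap (m := ∞) (by simp)) _).comp r hX
  have h := covDeriv_mfderiv (f := fun r : M => r) (s := Set.univ) hι hu hX u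
  have h' := congrArg (tangentCoord p' (ι r)) h
  rw [tangentCoord_add, tangentCoord_covDeriv hr' hu hιX, tangentCoord_mfderiv hι.1 hr hr',
    tangentCoord_covDeriv hr hu hX, hid, ofTangentCoord_tangentCoord hr,
    chartCovDeriv_mfderiv (f := fun r : M => r) hι.1 hr hr' hu hX, chartCovDeriv,
    dirDeriv_extChartAt_comp (f := fun r : M => r) hr hu mdifferentiableWithinAt_id, hid,
    dirDeriv_eq_zero (h := fun y => tangentCoord p y (ofTangentCoord p y (tangentCoord p r v)))
      hu _ (tangentCoord_ofTangentCoord hr _), ContinuousLinearMap.map_zero, zero_add, zero_add,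
    ofTangentCoord_tangentCoord hr] at h'
  · rw [chartSecondForm, h']
    abel
  · filter_upwards [mem_nhdsWithin_of_mem_nhds ((chartAt _ p).open_source.mem_nhds hr)] with y hy
      using tangentCoord_ofTangentCoord hy _

lemma secondFundamentalForm_add_right (hι : IsIsometricImmersion m q ι) (p : M)
    (u v w : TangentSpace (𝓡 m) p) : secondFundamentalForm m q ι p u (v + w) =
      secondFundamentalForm m q ι p u v + secondFundamentalForm m q ι p u w := by
  apply tangentCoord_injective (mem_chart_source _ _)
  simp only [tangentCoord_add, tangentCoord_secondFundamentalForm hι (mem_chart_source _ p)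
    (mem_chart_source _ (ι p)), chartSecondForm, ContinuousLinearMap.map_add,
    christoffelVec_add_right]
  abel

lemma secondFundamentalForm_smul_right (hι : IsIsometricImmersion m q ι) (p : M) (c : ℝ)
    (u v : TangentSpace (𝓡 m) p) : secondFundamentalForm m q ι p u (c • v) =
      c • secondFundamentalForm m q ι p u v := by
  apply tangentCoord_injective (mem_chart_source _ _)
  simp only [tangentCoord_smul, tangentCoord_secondFundamentalForm hι (mem_chart_source _ p)
    (mem_chart_source _ (ι p)), chartSecondForm, ContinuousLinearMap.map_smul,
    christoffelVec_smul_right, smul_add, smul_sub]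

/-- The characterization of the shape operator, for the definition by an orthonormal basis. It needs
linearity of `α` in its second argument. -/
lemma inner_shapeOperator (hι : IsIsometricImmersion m q ι) (p : M)
    (η : TangentSpace (𝓡 q) (ι p)) (u v : TangentSpace (𝓡 m) p) :
    inner ℝ (shapeOperator m q ι p η u) v = -inner ℝ (secondFundamentalForm m q ι p u v) η := by
  let L : TangentSpace (𝓡 m) p →ₗ[ℝ] TangentSpace (𝓡 q) (ι p) :=
    { toFun := fun v => secondFundamentalForm m q ι p u v
      map_add' := secondFundamentalForm_add_right hι p u
      map_smul' := fun c v => secondFundamentalForm_smul_right hι p c u v }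
  have hL : secondFundamentalForm m q ι p u v = L v := rfl
  rw [hL, ← (stdOrthonormalBasis ℝ (TangentSpace (𝓡 m) p)).sum_repr' v, map_sum, shapeOperator,
    inner_neg_left, sum_inner, sum_inner]
  congr 1
  refine Finset.sum_congr rfl fun j _ => ?_
  rw [map_smul, inner_smul_left, inner_smul_left,
    (stdOrthonormalBasis ℝ (TangentSpace (𝓡 m) p)).sum_repr' v]
  exact mul_comm _ _

/-- On a totally umbilic immersion, `α(u, v) = ⟨u, v⟩ H`. The difference `D` of the two sides is
normal; umbilicity in the direction `D` says that `⟨α(·, ·), D⟩` is a multiple of the metric, and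
the trace identifies the multiple as `⟨H, D⟩`, so that `D` is orthogonal to itself. -/
lemma secondFundamentalForm_eq_of_umbilic (hι : IsIsometricImmersion m q ι)
    (humb : IsTotallyUmbilic m q ι) (hm : m ≠ 0) (p : M) (u v : TangentSpace (𝓡 m) p) :
    secondFundamentalForm m q ι p u v = inner ℝ u v • meanCurvature m q ι p := by
  set D := secondFundamentalForm m q ι p u v - inner ℝ u v • meanCurvature m q ι p with hD
  have hmem : D ∈ normalSpace m q ι p := Submodule.sub_mem _ (secondFundamentalForm_mem p u v)
    (Submodule.smul_mem _ _ (meanCurvature_mem p))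
  obtain ⟨a, ha⟩ := humb p D hmem
  have h1 : ∀ u v, inner ℝ (secondFundamentalForm m q ι p u v) D = -(a * inner ℝ u v) := by
    intro u v
    have := inner_shapeOperator hι p D u v
    rw [ha, inner_smul_left] at this
    simp at this
    linarith
  have h2 : inner ℝ (meanCurvature m q ι p) D = -a := by
    have hfr : Module.finrank ℝ (TangentSpace (𝓡 m) p) = m := finrank_euclideanSpace_fin
    rw [meanCurvature, inner_smul_left, sum_inner]
    simp only [h1, OrthonormalBasis.inner_eq_one, Finset.sum_const, Finset.card_univ,
      Fintype.card_fin, hfr, nsmul_eq_mul]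
    simp
    field_simp
  have h3 : inner ℝ D D = 0 := by
    conv_lhs => rw [hD]
    rw [inner_sub_left, inner_smul_left, h1, h2]
    simp
    ring
  exact sub_eq_zero.1 (inner_self_eq_zero.1 h3)

lemma contDiffAt_chartSecondForm (hι : IsIsometricImmersion m q ι) {p r : M} {p' : Q}
    (hr : r ∈ (chartAt (EuclideanSpace ℝ (Fin m)) p).source)
    (hr' : ι r ∈ (chartAt (EuclideanSpace ℝ (Fin q)) p').source) (a b : EuclideanSpace ℝ (Fin m)) :
    ContDiffAt ℝ ∞ (fun x => chartSecondForm m q ι p p' x a b) (extChartAt (𝓡 m) p r) := by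
  have hΦ : ContDiffAt ℝ ∞ (chartExpr m q ι p p') (extChartAt (𝓡 m) p r) :=
    contDiffAt_chartExpr_extChartAt hι.1 hr hr'
  have hΦ1 : ContDiffAt ℝ ∞ (fderiv ℝ (chartExpr m q ι p p')) (extChartAt (𝓡 m) p r) :=
    hΦ.fderiv_right (m := ∞) (by simp)
  have hΦ2 : ContDiffAt ℝ ∞ (fderiv ℝ (fderiv ℝ (chartExpr m q ι p p'))) (extChartAt (𝓡 m) p r) :=
    hΦ1.fderiv_right (m := ∞) (by simp)
  have ht : chartExpr m q ι p p' (extChartAt (𝓡 m) p r) ∈ (extChartAt (𝓡 q) p').target := by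
    rw [chartExpr_extChartAt ι p' hr]
    exact extChartAt_mem_target hr'
  have hΓ' := contMDiffWithinAt_christoffelVec (J := 𝓡 m) (s := Set.univ) ht hΦ.contMDiffAt
    (hΦ1.clm_apply (contDiffAt_const (c := a))).contMDiffAt
    (hΦ1.clm_apply (contDiffAt_const (c := b))).contMDiffAt
  have hΓ := contMDiffWithinAt_christoffelVec (J := 𝓡 m) (s := Set.univ) (x := fun x => x)
    (extChartAt_mem_target hr) contMDiffWithinAt_id (contMDiffWithinAt_const (c := a))
    (contMDiffWithinAt_const (c := b))
  unfold chartSecondForm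
  exact (((hΦ2.clm_apply contDiffAt_const).clm_apply contDiffAt_const).add
    (contMDiffAt_iff_contDiffAt.1 hΓ')).sub (hΦ1.clm_apply (contMDiffAt_iff_contDiffAt.1 hΓ))

/-- Orthonormal bases of the tangent spaces are chosen without any regularity, so the definition of
`H` does not show that it is smooth. On a totally umbilic immersion `H = α(e, e) / ⟨e, e⟩` for a
nonvanishing local field `e`. -/
lemma contMDiff_meanCurvature (hι : IsIsometricImmersion m q ι)
    (humb : IsTotallyUmbilic m q ι) (hm : m ≠ 0) :
    ContMDiff (𝓡 m) (𝓡 q).tangent ∞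
      (fun r => (⟨ι r, meanCurvature m q ι r⟩ : TangentBundle (𝓡 q) Q)) := by
  intro p
  have hz : p ∈ (chartAt (EuclideanSpace ℝ (Fin m)) p).source := mem_chart_source _ _
  have hz' : ι p ∈ (chartAt (EuclideanSpace ℝ (Fin q)) (ι p)).source := mem_chart_source _ _
  refine (contMDiffWithinAt_field_iff (s := Set.univ) hz').2 ⟨hι.1 p, ?_⟩
  set e : EuclideanSpace ℝ (Fin m) := EuclideanSpace.single ⟨0, Nat.pos_of_ne_zero hm⟩ 1
  have he : e ≠ 0 := by simp [e]
  have hpos := metricForm_pos (extChartAt_mem_target hz) he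
  have hsm : ContDiffAt ℝ ∞ (fun x => (metricForm m p x e e)⁻¹ •
      chartSecondForm m q ι p (ι p) x e e)
      (extChartAt (𝓡 m) p p) :=
    ((((contDiffAt_metricForm (extChartAt_mem_target hz)).clm_apply contDiffAt_const).clm_apply
      contDiffAt_const).inv hpos.ne').smul (contDiffAt_chartSecondForm hι hz hz' e e)
  have hcomp := hsm.contMDiffAt.comp p (contMDiffAt_extChartAt' (I := 𝓡 m) (n := ∞) hz)
  refine hcomp.congr_of_eventuallyEq ?_
  filter_upwards [(chartAt _ p).open_source.mem_nhds hz,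
    hι.1.continuous.continuousAt.preimage_mem_nhds ((chartAt _ (ι p)).open_source.mem_nhds hz')]
    with r hr hr'
  have h := tangentCoord_secondFundamentalForm hι hr hr' (ofTangentCoord p r e)
    (ofTangentCoord p r e)
  have hpos' := metricForm_pos (extChartAt_mem_target hr) he
  rw [secondFundamentalForm_eq_of_umbilic hι humb hm, tangentCoord_smul,
    tangentCoord_ofTangentCoord hr, ← metricForm_tangentCoord hr,
    tangentCoord_ofTangentCoord hr] at h
  simp only [Function.comp]
  rw [← h, smul_smul, inv_mul_cancel₀ hpos'.ne', one_smul]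

end Umbilic

/-! ### Vector fields along curves -/

section Curve
variable {m q : ℕ} {M : Type*} [TopologicalSpace M] [ChartedSpace (EuclideanSpace ℝ (Fin m)) M]
  [IsManifold (𝓡 m) ∞ M]
  [RiemannianBundle (fun x : M => TangentSpace (𝓡 m) x)]
  {Q : Type*} [TopologicalSpace Q] [ChartedSpace (EuclideanSpace ℝ (Fin q)) Q]
  [IsManifold (𝓡 q) ∞ Q]
  [RiemannianBundle (fun x : Q => TangentSpace (𝓡 q) x)]
  {ι : M → Q} {γ : ℝ → M} {I : Set ℝ}

lemma dirDeriv_real_eq {G : Type*} [NormedAddCommGroup G] [NormedSpace ℝ G] (h : ℝ → G) (t : ℝ) :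
    dirDeriv 𝓘(ℝ, ℝ) h I t (1 : ℝ) = fderivWithin ℝ h I t 1 := by
  exact congrArg (fun L : ℝ →L[ℝ] G => L 1) mfderivWithin_eq_fderivWithin

lemma contMDiffWithinAt_dirDeriv {G : Type*} [NormedAddCommGroup G] [NormedSpace ℝ G] {h : ℝ → G}
    (hI : UniqueDiffOn ℝ I) {t : ℝ} (ht : t ∈ I)
    (hh : ContMDiffWithinAt 𝓘(ℝ, ℝ) 𝓘(ℝ, G) ∞ h I t) :
    ContMDiffWithinAt 𝓘(ℝ, ℝ) 𝓘(ℝ, G) ∞ (fun t => dirDeriv 𝓘(ℝ, ℝ) h I t (1 : ℝ)) I t := by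
  simp_rw [dirDeriv_real_eq]
  exact ((hh.contDiffWithinAt.fderivWithin_right (m := ∞) hI (by simp) ht).clm_apply
    contDiffWithinAt_const).contMDiffWithinAt

omit [IsManifold (𝓡 m) ∞ M] [RiemannianBundle (fun x : M => TangentSpace (𝓡 m) x)] in
lemma eventually_mem_source (hγ : ContMDiffOn 𝓘(ℝ, ℝ) (𝓡 m) ∞ γ I) {t : ℝ} (ht : t ∈ I) :
    ∀ᶠ y in 𝓝[I] t, γ y ∈ (chartAt (EuclideanSpace ℝ (Fin m)) (γ t)).source :=
  (hγ t ht).continuousWithinAt ((chartAt _ (γ t)).open_source.mem_nhds (mem_chart_source _ _))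

omit [RiemannianBundle (fun x : M => TangentSpace (𝓡 m) x)] in
lemma isSmoothAlong_velocity (hI : UniqueDiffOn ℝ I) (hγ : ContMDiffOn 𝓘(ℝ, ℝ) (𝓡 m) ∞ γ I) :
    IsSmoothAlong m γ I (velocity m γ I) := by
  intro t ht
  have hz : γ t ∈ (chartAt (EuclideanSpace ℝ (Fin m)) (γ t)).source := mem_chart_source _ _
  refine (contMDiffWithinAt_field_iff hz).2 ⟨hγ t ht, ?_⟩
  have h1 := contMDiffWithinAt_dirDeriv hI ht (contMDiffWithinAt_extChartAt_comp hz (hγ t ht))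
  refine h1.congr_of_eventuallyEq_of_mem ?_ ht
  filter_upwards [eventually_mem_source hγ ht, self_mem_nhdsWithin] with y hy hyI
  exact (dirDeriv_extChartAt_comp hy (hI y hyI).uniqueMDiffWithinAt
    ((hγ y hyI).mdifferentiableWithinAt (by simp)) (1 : ℝ)).symm

omit [RiemannianBundle (fun x : M => TangentSpace (𝓡 m) x)] in
lemma IsSmoothAlong.smul {W : ∀ t, TangentSpace (𝓡 m) (γ t)} {g : ℝ → ℝ}
    (hW : IsSmoothAlong m γ I W) (hg : ContMDiffOn 𝓘(ℝ, ℝ) 𝓘(ℝ, ℝ) ∞ g I) :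
    IsSmoothAlong m γ I fun t => g t • W t := by
  intro t ht
  have hz : γ t ∈ (chartAt (EuclideanSpace ℝ (Fin m)) (γ t)).source := mem_chart_source _ _
  obtain ⟨h1, h2⟩ := (contMDiffWithinAt_field_iff hz).1 (hW t ht)
  refine (contMDiffWithinAt_field_iff hz).2 ⟨h1, ?_⟩
  simp_rw [tangentCoord_smul]
  exact (hg t ht).smul h2

omit [RiemannianBundle (fun x : M => TangentSpace (𝓡 m) x)] in
lemma IsSmoothAlong.contMDiffOn {W : ∀ t, TangentSpace (𝓡 m) (γ t)}
    (hW : IsSmoothAlong m γ I W) : ContMDiffOn 𝓘(ℝ, ℝ) (𝓡 m) ∞ γ I :=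
  fun t ht => ((contMDiffWithinAt_field_iff (mem_chart_source _ (γ t))).1 (hW t ht)).1

lemma covDerivAlong_congr {W V : ∀ t, TangentSpace (𝓡 m) (γ t)} (h : ∀ t ∈ I, V t = W t) {t : ℝ}
    (ht : t ∈ I) : covDerivAlong m γ I V t = covDerivAlong m γ I W t := by
  have key : ∀ u : TangentSpace 𝓘(ℝ, ℝ) t,
      covDeriv 𝓘(ℝ, ℝ) γ I V t u = covDeriv 𝓘(ℝ, ℝ) γ I W t u := by
    intro u
    have h1 : dirDeriv 𝓘(ℝ, ℝ) (fun y => tangentCoord (γ t) (γ y) (V y)) I t u =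
        dirDeriv 𝓘(ℝ, ℝ) (fun y => tangentCoord (γ t) (γ y) (W y)) I t u := by
      rw [dirDeriv, dirDeriv, mfderivWithin_congr (fun y hy => by rw [h y hy]) (by rw [h t ht])]
      rfl
    rw [covDeriv_eq_chartCovDeriv, covDeriv_eq_chartCovDeriv, chartCovDeriv, chartCovDeriv, h1,
      h t ht]
  exact key _

omit [RiemannianBundle (fun x : M => TangentSpace (𝓡 m) x)]
  [RiemannianBundle (fun x : Q => TangentSpace (𝓡 q) x)] in
lemma IsSmoothAlong.mfderiv (hι : ContMDiff (𝓡 m) (𝓡 q) ∞ ι) {W : ∀ t, TangentSpace (𝓡 m) (γ t)}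
    (hW : IsSmoothAlong m γ I W) :
    IsSmoothAlong q (fun t => ι (γ t)) I fun t => mfderiv (𝓡 m) (𝓡 q) ι (γ t) (W t) :=
  fun t ht => ((hι.contMDiff_tangentMap (m := ∞) (by simp)) _).comp_contMDiffWithinAt t (hW t ht)

omit [IsManifold (𝓡 m) ∞ M] [RiemannianBundle (fun x : M => TangentSpace (𝓡 m) x)]
  [IsManifold (𝓡 q) ∞ Q] [RiemannianBundle (fun x : Q => TangentSpace (𝓡 q) x)] in
lemma velocity_comp (hι : ContMDiff (𝓡 m) (𝓡 q) ∞ ι) (hI : UniqueDiffOn ℝ I)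
    (hγ : ContMDiffOn 𝓘(ℝ, ℝ) (𝓡 m) ∞ γ I) {t : ℝ} (ht : t ∈ I) :
    velocity q (ι ∘ γ) I t = mfderiv (𝓡 m) (𝓡 q) ι (γ t) (velocity m γ I t) := by
  have h := mfderiv_comp_mfderivWithin t (hι.mdifferentiableAt (x := γ t) (by simp))
    ((hγ t ht).mdifferentiableWithinAt (by simp)) (hI t ht).uniqueMDiffWithinAt
  rw [velocity, h]
  rfl

variable [IsContMDiffRiemannianBundle (𝓡 m) ∞ (EuclideanSpace ℝ (Fin m))
      (fun x : M => TangentSpace (𝓡 m) x)]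

lemma IsSmoothAlong.covDerivAlong (hI : UniqueDiffOn ℝ I) {W : ∀ t, TangentSpace (𝓡 m) (γ t)}
    (hW : IsSmoothAlong m γ I W) :
    IsSmoothAlong m γ I (PlanarShape.covDerivAlong m γ I W) := by
  have hγ := hW.contMDiffOn
  intro t ht
  have hz : γ t ∈ (chartAt (EuclideanSpace ℝ (Fin m)) (γ t)).source := mem_chart_source _ _
  obtain ⟨h1, h2⟩ := (contMDiffWithinAt_field_iff hz).1 (hW t ht)
  refine (contMDiffWithinAt_field_iff hz).2 ⟨hγ t ht, ?_⟩
  have h3 := contMDiffWithinAt_extChartAt_comp hz h1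
  have h4 := contMDiffWithinAt_christoffelVec (p := γ t)
    (x := fun y => extChartAt (𝓡 m) (γ t) (γ y)) (extChartAt_mem_target hz) h3
    (contMDiffWithinAt_dirDeriv hI ht h3) h2
  have h5 := (contMDiffWithinAt_dirDeriv hI ht h2).add h4
  refine h5.congr_of_eventuallyEq_of_mem ?_ ht
  filter_upwards [eventually_mem_source hγ ht, self_mem_nhdsWithin] with y hy hyI
  exact tangentCoord_covDeriv hy (hI y hyI).uniqueMDiffWithinAt (hW y hyI) (1 : ℝ)

lemma IsSmoothAlong.contMDiffOn_inner {W V : ∀ t, TangentSpace (𝓡 m) (γ t)}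
    (hW : IsSmoothAlong m γ I W) (hV : IsSmoothAlong m γ I V) :
    ContMDiffOn 𝓘(ℝ, ℝ) 𝓘(ℝ, ℝ) ∞ (fun t => inner ℝ (W t) (V t)) I :=
  ContMDiffOn.inner_bundle (F := EuclideanSpace ℝ (Fin m)) (E := fun x : M => TangentSpace (𝓡 m) x)
    hW hV

/-- The derivative of a constant inner product vanishes. -/
lemma inner_covDerivAlong_add_of_const (hI : UniqueDiffOn ℝ I) {W V : ∀ t, TangentSpace (𝓡 m) (γ t)}
    (hW : IsSmoothAlong m γ I W) (hV : IsSmoothAlong m γ I V) {a : ℝ}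
    (h : ∀ t ∈ I, inner ℝ (W t) (V t) = a) {t : ℝ} (ht : t ∈ I) :
    inner ℝ (covDerivAlong m γ I W t) (V t) + inner ℝ (W t) (covDerivAlong m γ I V t) = 0 := by
  have hs := (hI t ht).uniqueMDiffWithinAt
  refine (dirDeriv_inner hs (hW t ht) (hV t ht) (1 : ℝ)).symm.trans ?_
  exact dirDeriv_eq_zero hs (by filter_upwards [self_mem_nhdsWithin] with y hy using h y hy)
    (h t ht) _

end Curve

/-! ### The normalized mean curvature vector along a curve -/

section MeanCurvature
variable {m q : ℕ} {M : Type*} [TopologicalSpace M] [ChartedSpace (EuclideanSpace ℝ (Fin m)) M]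
  [IsManifold (𝓡 m) ∞ M]
  [RiemannianBundle (fun x : M => TangentSpace (𝓡 m) x)]
  [IsContMDiffRiemannianBundle (𝓡 m) ∞ (EuclideanSpace ℝ (Fin m))
      (fun x : M => TangentSpace (𝓡 m) x)]
  {Q : Type*} [TopologicalSpace Q] [ChartedSpace (EuclideanSpace ℝ (Fin q)) Q]
  [IsManifold (𝓡 q) ∞ Q]
  [RiemannianBundle (fun x : Q => TangentSpace (𝓡 q) x)]
  [IsContMDiffRiemannianBundle (𝓡 q) ∞ (EuclideanSpace ℝ (Fin q))
      (fun x : Q => TangentSpace (𝓡 q) x)]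
  {ι : M → Q} {γ : ℝ → M} {I : Set ℝ}

lemma contMDiff_norm_inv_meanCurvature (hι : IsIsometricImmersion m q ι)
    (humb : IsTotallyUmbilic m q ι) (hm : m ≠ 0) (hH : ∀ p : M, meanCurvature m q ι p ≠ 0) :
    ContMDiff (𝓡 m) 𝓘(ℝ, ℝ) ∞ fun r => ‖meanCurvature m q ι r‖⁻¹ := by
  intro p
  have hsm := contMDiff_meanCurvature hι humb hm p
  have h := ContMDiffAt.inner_bundle (F := EuclideanSpace ℝ (Fin q))
    (E := fun x : Q => TangentSpace (𝓡 q) x) hsm hsm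
  have hne : inner ℝ (meanCurvature m q ι p) (meanCurvature m q ι p) ≠ 0 :=
    inner_self_ne_zero.2 (hH p)
  have hout : ContDiffAt ℝ ∞ (fun x : ℝ => (√x)⁻¹)
      (inner ℝ (meanCurvature m q ι p) (meanCurvature m q ι p)) :=
    (Real.contDiffAt_sqrt hne).inv (by
      rw [← norm_eq_sqrt_real_inner]; exact norm_ne_zero_iff.2 (hH p))
  have h2 := hout.contMDiffAt.comp p h
  refine h2.congr_of_eventuallyEq (.of_forall fun r => ?_)
  simp only [Function.comp]
  rw [norm_eq_sqrt_real_inner]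

lemma contMDiff_normalized_meanCurvature (hι : IsIsometricImmersion m q ι)
    (humb : IsTotallyUmbilic m q ι) (hm : m ≠ 0) (hH : ∀ p : M, meanCurvature m q ι p ≠ 0) :
    ContMDiff (𝓡 m) (𝓡 q).tangent ∞ fun r =>
      (⟨ι r, ‖meanCurvature m q ι r‖⁻¹ • meanCurvature m q ι r⟩ : TangentBundle (𝓡 q) Q) := by
  intro p
  have hz' : ι p ∈ (chartAt (EuclideanSpace ℝ (Fin q)) (ι p)).source := mem_chart_source _ _
  obtain ⟨h1, h2⟩ := (contMDiffWithinAt_field_iff (s := Set.univ) hz').1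
    (contMDiff_meanCurvature hι humb hm p)
  refine (contMDiffWithinAt_field_iff (s := Set.univ) hz').2 ⟨h1, ?_⟩
  simp_rw [tangentCoord_smul]
  exact ContMDiffWithinAt.smul (contMDiff_norm_inv_meanCurvature hι humb hm hH p) h2

/-- When `H / ‖H‖` is parallel in the normal bundle, its ambient derivative along a curve in `M` is
tangential. -/
lemma inner_covDeriv_normalized_meanCurvature (hι : IsIsometricImmersion m q ι)
    (humb : IsTotallyUmbilic m q ι) (hm : m ≠ 0)
    (hpar : HasParallelNormalizedMeanCurvature m q ι) (hI : UniqueDiffOn ℝ I)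
    (hγ : ContMDiffOn 𝓘(ℝ, ℝ) (𝓡 m) ∞ γ I) {t : ℝ} (ht : t ∈ I) {ξ : TangentSpace (𝓡 q) (ι (γ t))}
    (hξ : ξ ∈ normalSpace m q ι (γ t)) :
    inner ℝ ξ (covDerivAlong q (fun t => ι (γ t)) I
      (fun t => ‖meanCurvature m q ι (γ t)‖⁻¹ • meanCurvature m q ι (γ t)) t) = 0 := by
  have h := covDeriv_comp (ξ := fun r => ‖meanCurvature m q ι r‖⁻¹ • meanCurvature m q ι r)
    (hI t ht).uniqueMDiffWithinAt ((hγ t ht).mdifferentiableWithinAt (by simp))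
    (contMDiff_normalized_meanCurvature hι humb hm hpar.1 (γ t)) (1 : ℝ)
  refine (congrArg (inner ℝ ξ) h).trans ?_
  have h2 := hpar.2 (γ t) (mfderivWithin 𝓘(ℝ, ℝ) (𝓡 m) γ I t (1 : ℝ))
  rw [normalCovDeriv, normalProj, Submodule.starProjection_apply_eq_zero_iff,
    Submodule.mem_orthogonal] at h2
  exact h2 ξ hξ

/-- The Gauss formula along a curve in a totally umbilic submanifold. -/
lemma covDerivAlong_mfderiv_of_umbilic (hι : IsIsometricImmersion m q ι)
    (humb : IsTotallyUmbilic m q ι) (hm : m ≠ 0) (hI : UniqueDiffOn ℝ I)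
    {W : ∀ t, TangentSpace (𝓡 m) (γ t)} (hW : IsSmoothAlong m γ I W) {t : ℝ} (ht : t ∈ I) :
    covDerivAlong q (fun t => ι (γ t)) I (fun t => mfderiv (𝓡 m) (𝓡 q) ι (γ t) (W t)) t =
      mfderiv (𝓡 m) (𝓡 q) ι (γ t) (covDerivAlong m γ I W t) +
        inner ℝ (velocity m γ I t) (W t) • meanCurvature m q ι (γ t) := by
  rw [← secondFundamentalForm_eq_of_umbilic hι humb hm]
  exact covDeriv_mfderiv hι (hI t ht).uniqueMDiffWithinAt (hW t ht) (1 : ℝ)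

end MeanCurvature

/-! ### Curves with planar extrinsic shape -/

section Main
variable {m q : ℕ} {M : Type*} [TopologicalSpace M] [ChartedSpace (EuclideanSpace ℝ (Fin m)) M]
  [IsManifold (𝓡 m) ∞ M]
  [RiemannianBundle (fun x : M => TangentSpace (𝓡 m) x)]
  [IsContMDiffRiemannianBundle (𝓡 m) ∞ (EuclideanSpace ℝ (Fin m))
      (fun x : M => TangentSpace (𝓡 m) x)]
  {Q : Type*} [TopologicalSpace Q] [ChartedSpace (EuclideanSpace ℝ (Fin q)) Q]
  [IsManifold (𝓡 q) ∞ Q]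
  [RiemannianBundle (fun x : Q => TangentSpace (𝓡 q) x)]
  [IsContMDiffRiemannianBundle (𝓡 q) ∞ (EuclideanSpace ℝ (Fin q))
      (fun x : Q => TangentSpace (𝓡 q) x)]
  {ι : M → Q} {γ : ℝ → M} {I : Set ℝ}

/-- The acceleration of a unit-speed curve is orthogonal to its velocity. -/
lemma inner_acceleration_velocity (hI : UniqueDiffOn ℝ I)
    (hγ : IsUnitSpeedCurve m γ I) {t : ℝ} (ht : t ∈ I) :
    inner ℝ (velocity m γ I t) (acceleration m γ I t) = 0 := by
  have hT := isSmoothAlong_velocity hI hγ.1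
  have h := inner_covDerivAlong_add_of_const hI hT hT (a := 1)
    (fun t ht => by rw [real_inner_self_eq_norm_sq, hγ.2 t ht, one_pow]) ht
  rw [real_inner_comm (velocity m γ I t)] at h
  change inner ℝ (velocity m γ I t) (covDerivAlong m γ I (velocity m γ I) t) = 0
  linarith

/-- A unit-speed curve with planar extrinsic shape, in a totally umbilic submanifold with parallel
normalized mean curvature vector, has geodesic curvature proportional to `‖H‖`. The constant is
`√(1 / b² - 1)`, where `b` is the constant value of `⟨Y, H / ‖H‖⟩`. -/
lemma exists_curvature_eq (hι : IsIsometricImmersion m q ι)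
    (humb : IsTotallyUmbilic m q ι) (hm : m ≠ 0)
    (hpar : HasParallelNormalizedMeanCurvature m q ι) (hI : UniqueDiffOn ℝ I) (hconv : Convex ℝ I)
    (hne : I.Nonempty)
    (hγ : IsUnitSpeedCurve m γ I) (hplanar : IsPlanar q (ι ∘ γ) I) :
    ∃ c : ℝ, ∀ t ∈ I, ‖acceleration m γ I t‖ = c * ‖meanCurvature m q ι (γ t)‖ := by
  obtain ⟨hι', Y, k, ⟨hY, hY1⟩, hk, hYk⟩ := hplanar
  have hT := isSmoothAlong_velocity hI hγ.1
  have hA : IsSmoothAlong m γ I (acceleration m γ I) := hT.covDerivAlong hI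
  have hdA := hA.mfderiv hι.1
  set H : ∀ t : ℝ, TangentSpace (𝓡 q) (ι (γ t)) := fun t => meanCurvature m q ι (γ t)
  set ν : ∀ t : ℝ, TangentSpace (𝓡 q) (ι (γ t)) := fun t => ‖H t‖⁻¹ • H t with hν_def
  have hν : IsSmoothAlong q (fun t => ι (γ t)) I ν := fun t ht =>
    (contMDiff_normalized_meanCurvature hι humb hm hpar.1 (γ t)).comp_contMDiffWithinAt t
      (hγ.1 t ht)
  have hHpos : ∀ t, 0 < ‖H t‖ := fun t => norm_pos_iff.2 (hpar.1 (γ t))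
  have hHmem : ∀ t, H t ∈ normalSpace m q ι (γ t) := fun t => meanCurvature_mem _
  have hνmem : ∀ t, ν t ∈ normalSpace m q ι (γ t) := fun t => Submodule.smul_mem _ _ (hHmem t)
  have hHν : ∀ t, inner ℝ (H t) (ν t) = ‖H t‖ := fun t => by
    rw [hν_def]
    simp only
    rw [inner_smul_right, real_inner_self_eq_norm_sq]
    have := (hHpos t).ne'
    field_simp
  -- the Gauss formula for the velocity, with `α(T, T) = H`
  have hgauss : ∀ t ∈ I, k t • Y t =
      mfderiv (𝓡 m) (𝓡 q) ι (γ t) (acceleration m γ I t) + H t := by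
    intro t ht
    have h1 := covDerivAlong_mfderiv_of_umbilic hι humb hm hI hT ht
    rw [real_inner_self_eq_norm_sq, hγ.2 t ht, one_pow, one_smul] at h1
    have h2 : covDerivAlong q (fun t => ι (γ t)) I (velocity q (ι ∘ γ) I) t = _ :=
      covDerivAlong_congr (fun t ht => velocity_comp hι.1 hI hγ.1 ht) ht
    exact (hYk t ht).1.symm.trans (h2.trans h1)
  have hkf : ∀ t ∈ I, k t * inner ℝ (Y t) (ν t) = ‖H t‖ := by
    intro t ht
    have h := congrArg (fun w => inner ℝ w (ν t)) (hgauss t ht)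
    simp only [inner_smul_left, inner_add_left, inner_mfderiv_of_mem_normalSpace _ (hνmem t), hHν,
      zero_add] at h
    exact h
  have hk0 : ∀ t ∈ I, k t ≠ 0 := fun t ht h0 => by
    have h := hkf t ht
    rw [h0, zero_mul] at h
    exact (hHpos t).ne h
  -- `ν' := ∇~_T ν` is orthogonal to both summands of `k Y = dι (∇_T T) + H`: to `H` because `ν` is
  -- parallel, and to `dι (∇_T T)` because `0 = ⟨dι (∇_T T), ν⟩'` and `⟨T, ∇_T T⟩ = 0`
  have hYν : ∀ t ∈ I, inner ℝ (Y t) (covDerivAlong q (fun t => ι (γ t)) I ν t) = 0 := by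
    intro t ht
    have h1 : inner ℝ (H t) (covDerivAlong q (fun t => ι (γ t)) I ν t) = 0 :=
      inner_covDeriv_normalized_meanCurvature hι humb hm hpar hI hγ.1 ht (hHmem t)
    have h2 := inner_covDerivAlong_add_of_const hI hdA hν (a := 0)
      (fun t _ => inner_mfderiv_of_mem_normalSpace _ (hνmem t)) ht
    rw [covDerivAlong_mfderiv_of_umbilic hι humb hm hI hA ht,
      inner_acceleration_velocity hI hγ ht, zero_smul, add_zero,
      inner_mfderiv_of_mem_normalSpace _ (hνmem t), zero_add] at h2
    have h3 := congrArg (fun w => inner ℝ w (covDerivAlong q (fun t => ι (γ t)) I ν t))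
      (hgauss t ht)
    simp only [inner_smul_left, inner_add_left, h1, h2, add_zero] at h3
    exact (mul_eq_zero.1 h3).resolve_left (hk0 t ht)
  have hf : ∀ t ∈ I, dirDeriv 𝓘(ℝ, ℝ) (fun t => inner ℝ (Y t) (ν t)) I t (1 : ℝ) = 0 := by
    intro t ht
    have h1 := dirDeriv_inner (f := fun t => ι (γ t)) (hI t ht).uniqueMDiffWithinAt (hY t ht)
      (hν t ht) (1 : ℝ)
    refine h1.trans ?_
    change inner ℝ (covDerivAlong q (ι ∘ γ) I Y t) (ν t) +
      inner ℝ (Y t) (covDerivAlong q (fun t => ι (γ t)) I ν t) = 0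
    rw [hYν t ht, (hYk t ht).2, velocity_comp hι.1 hI hγ.1 ht, add_zero]
    refine (inner_smul_left _ _ _).trans ?_
    rw [inner_mfderiv_of_mem_normalSpace _ (hνmem t), mul_zero]
  obtain ⟨t₀, ht₀⟩ := hne
  have hfsm : DifferentiableOn ℝ (fun t => inner ℝ (Y t) (ν t)) I :=
    (IsSmoothAlong.contMDiffOn_inner (γ := fun t => ι (γ t)) hY hν).contDiffOn.differentiableOn
      (by simp)
  have hconst : ∀ t ∈ I, inner ℝ (Y t) (ν t) = inner ℝ (Y t₀) (ν t₀) := by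
    intro t ht
    refine hconv.is_const_of_fderivWithin_eq_zero hfsm (fun x hx => ?_) ht ht₀
    ext
    rw [← dirDeriv_real_eq, hf x hx]
    rfl
  set b : ℝ := inner ℝ (Y t₀) (ν t₀)
  have hsq : ∀ t ∈ I, ‖acceleration m γ I t‖ ^ 2 = ‖H t‖ ^ 2 * (1 / b ^ 2 - 1) := by
    intro t ht
    have h1 := congrArg (fun w => ‖w‖ ^ 2) (hgauss t ht)
    rw [norm_smul, hY1 t ht, mul_one, norm_add_sq_real,
      inner_mfderiv_of_mem_normalSpace _ (hHmem t), norm_mfderiv hι, Real.norm_eq_abs, sq_abs] at h1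
    have h2 := hkf t ht
    rw [hconst t ht] at h2
    have hb : b ≠ 0 := fun h => by rw [h, mul_zero] at h2; exact (hHpos t).ne h2
    have h3 : k t ^ 2 = ‖H t‖ ^ 2 / b ^ 2 := by rw [← h2]; field_simp
    rw [h3] at h1
    linear_combination -h1
  refine ⟨√(1 / b ^ 2 - 1), fun t ht => ?_⟩
  rw [← Real.sqrt_sq (norm_nonneg (acceleration m γ I t)), hsq t ht,
    Real.sqrt_mul (sq_nonneg _), Real.sqrt_sq (norm_nonneg _), mul_comm]

end Main

end PlanarShape

end

theorem proposition1p4 (m q : ℕ)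
    {M : Type*} [TopologicalSpace M] [ChartedSpace (EuclideanSpace ℝ (Fin m)) M]
    [IsManifold (𝓡 m) ∞ M] [RiemannianBundle (fun x : M => TangentSpace (𝓡 m) x)]
    [IsContMDiffRiemannianBundle (𝓡 m) ∞ (EuclideanSpace ℝ (Fin m))
      (fun x : M => TangentSpace (𝓡 m) x)]
    {Q : Type*} [TopologicalSpace Q] [ChartedSpace (EuclideanSpace ℝ (Fin q)) Q]
    [IsManifold (𝓡 q) ∞ Q] [RiemannianBundle (fun x : Q => TangentSpace (𝓡 q) x)]
    [IsContMDiffRiemannianBundle (𝓡 q) ∞ (EuclideanSpace ℝ (Fin q))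
      (fun x : Q => TangentSpace (𝓡 q) x)]
    (ι : M → Q) (hι : PlanarShape.IsIsometricImmersion m q ι)
    (humb : PlanarShape.IsTotallyUmbilic m q ι)
    (hpar : PlanarShape.HasParallelNormalizedMeanCurvature m q ι)
    (I : Set ℝ) (hI : I.OrdConnected) (hI' : I.Nontrivial)
    (γ : ℝ → M) (hγ : ContMDiffOn 𝓘(ℝ, ℝ) (𝓡 m) ∞ γ I)
    (hplanar : PlanarShape.IsPlanar q (ι ∘ γ) I) :
    PlanarShape.IsPseudoGeodesic m q ι γ I ∧
      ∃ c : ℝ, ∀ t ∈ I,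
        PlanarShape.geodesicCurvature m γ I t = c * PlanarShape.normalCurvature m q ι γ I t := by
  open PlanarShape in
  have hconv : Convex ℝ I := hI.convex
  have hne : I.Nonempty := hI'.nonempty
  have hud : UniqueDiffOn ℝ I := uniqueDiffOn_convex hconv (by
    obtain ⟨x, hx, y, hy, hxy⟩ := hI'.exists_lt
    exact ⟨(x + y) / 2, interior_mono (hI.out hx hy) (by
      rw [interior_Icc]; constructor <;> linarith)⟩)
  have hm : m ≠ 0 := dim_ne_zero_of_meanCurvature_ne_zero (hpar.1 (γ hne.some))
  have hunit : IsUnitSpeedCurve m γ I := ⟨hγ, fun t ht => by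
    rw [← norm_mfderiv hι, ← velocity_comp hι.1 hud hγ ht]
    exact hplanar.1.2 t ht⟩
  obtain ⟨c, hc⟩ := exists_curvature_eq hι humb hm hpar hud hconv hne hunit hplanar
  -- `α(T, T) = H`, so that the normal curvature is `‖H‖`
  have hα : ∀ t ∈ I, normalAcceleration m q ι γ I t = meanCurvature m q ι (γ t) := by
    intro t ht
    rw [normalAcceleration, secondFundamentalForm_eq_of_umbilic hι humb hm,
      real_inner_self_eq_norm_sq, hunit.2 t ht, one_pow, one_smul]
  have hHpos : ∀ t, 0 < ‖meanCurvature m q ι (γ t)‖ := fun t => norm_pos_iff.2 (hpar.1 (γ t))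
  have hT := isSmoothAlong_velocity hud hγ
  have hY : ∃ Y : ∀ t : ℝ, TangentSpace (𝓡 m) (γ t), IsUnitFieldAlong m γ I Y ∧
      ∀ t ∈ I, acceleration m γ I t = (c * ‖meanCurvature m q ι (γ t)‖) • Y t := by
    rcases eq_or_ne c 0 with rfl | hc0
    · -- `γ` is a geodesic, and any smooth unit field will do
      refine ⟨velocity m γ I, ⟨hT, hunit.2⟩, fun t ht => ?_⟩
      rw [zero_mul, zero_smul, ← norm_eq_zero, hc t ht, zero_mul]
    · have hcp : ∀ t ∈ I, 0 < c * ‖meanCurvature m q ι (γ t)‖ := fun t ht =>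
        lt_of_le_of_ne (hc t ht ▸ norm_nonneg _) (mul_ne_zero hc0 (hHpos t).ne').symm
      refine ⟨fun t => (c⁻¹ * ‖meanCurvature m q ι (γ t)‖⁻¹) • acceleration m γ I t, ⟨?_, ?_⟩, ?_⟩
      · refine IsSmoothAlong.smul (hT.covDerivAlong hud) ?_
        exact contMDiffOn_const.mul
          ((contMDiff_norm_inv_meanCurvature hι humb hm hpar.1).comp_contMDiffOn hγ)
      · intro t ht
        rw [norm_smul, hc t ht, ← mul_inv, Real.norm_of_nonneg (inv_nonneg.2 (hcp t ht).le),
          inv_mul_cancel₀ (hcp t ht).ne']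
      · intro t ht
        rw [smul_smul, ← mul_inv, mul_inv_cancel₀ (hcp t ht).ne', one_smul]
  refine ⟨⟨c, hunit, ?_⟩, c, fun t ht => ?_⟩
  · obtain ⟨Y, hY1, hY2⟩ := hY
    refine ⟨Y, hY1, ?_⟩
    split_ifs with hq
    · refine ⟨fun t => ‖meanCurvature m q ι (γ t)‖⁻¹ • meanCurvature m q ι (γ t),
        ⟨fun t ht => ?_, ?_⟩, ?_, ?_⟩
      · exact (contMDiff_normalized_meanCurvature hι humb hm hpar.1 (γ t)).comp_contMDiffWithinAt t
          (hγ t ht)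
      · intro t ht
        rw [norm_smul, norm_inv, norm_norm]
        exact inv_mul_cancel₀ (hHpos t).ne'
      · exact fun t ht => Submodule.smul_mem _ _ (meanCurvature_mem _)
      · intro t ht
        rw [hα t ht, hY2 t ht, inner_smul_right, real_inner_self_eq_norm_sq]
        congr 2
        have := (hHpos t).ne'
        field_simp
    · intro t ht
      rw [normalCurvature, hα t ht, hY2 t ht]
  · rw [geodesicCurvature, normalCurvature, hα t ht, hc t ht]
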